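/- For $0<\theta<\pi/2$ let $S_\theta=\{z\in\mathbb C:\operatorname{Re}z>0,\ |\arg z|<\theta\}$. Let $0<\beta<\alpha<\pi/2$, and let $\mu$ be a complex Borel measure, not necessarily symmetric, carried by a compact subset of $S_\beta$, with $\mu(\mathbb C)=0$. Let $F(z)=\int e^{-z\xi}\,d\mu(\xi)$ be its Fourier--Borel transform and put $\widetilde F(z)=\overline{F(\overline z)}$, which is the Fourier--Borel transform of the measure $\widetilde\mu$ given by $\widetilde\mu(E)=\overline{\mu(\overline E)}$. Let $(T(t))_{t\in S_\alpha}$ be an analytic semigroup of bounded operators on a complex Banach space $\mathcal X$, that is, $T:S_\alpha\to\mathcal B(\mathcal X)$ is analytic and $T(s+t)=T(s)T(t)$ for all $s,t\in S_\alpha$ (no condition is imposed at $0$). Suppose that it is not quasinilpotent, i.e. $\rho(T(t))\neq 0$ for some $t\in S_\alpha$, where $\rho$ denotes the spectral radius. Write, formally, $T(t)=e^{tA}$, and for $u\in S_{\alpha-\beta}$ define $$F(-uA)=\int T(u\xi)\,d\mu(\xi),\qquad \widetilde F(-uA)=\int T(u\xi)\,d\widetilde\mu(\xi).$$ Let $\mathcal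 A_T$ be the closed (not necessarily unital) subalgebra of $\mathcal B(\mathcal X)$ generated by $\{T(t):t\in S_\alpha\}$, let $\operatorname{rad}\mathcal A_T$ be its Jacobson radical, and let $\pi:\mathcal A_T\to\mathcal A_T/\operatorname{rad}\mathcal A_T$ be the canonical surjection. If there exists $t_0>0$ such that $$\sup_{t\in S_{\alpha-\beta},\,|t|\le t_0}\rho\bigl(F(-tA)\,\widetilde F(-tA)\bigr)<\sup_{z\in S_{\alpha-\beta}}|F(z)|\,|\widetilde F(z)|,$$ then the algebra $\mathcal A_T/\operatorname{rad}\mathcal A_T$ is unital (with a nonzero identity element), and the generator of the semigroup $(\pi(T(t)))_{t\in S_\alpha}$, acting by multiplication on $\mathcal A_T/\operatorname{rad}\mathcal A_T$, that is, the operator $x\mapsto\lim_{t\to0+}t^{-1}(\pi(T(t))x-x)$ defined for those $x$ for which the limit exists, is an everywhere defined bounded operator. -/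

import Mathlib

open MeasureTheory Filter Topology
open scoped ENNReal ComplexConjugate

noncomputable section

namespace AnalyticSemigroup

/-! ### Sectors, complex measures and Fourier--Borel transforms -/

/-- The open sector `{z : Re z > 0, |arg z| < θ}`. -/
def sector (θ : ℝ) : Set ℂ := {z | 0 < z.re ∧ |z.arg| < θ}

/-- `μ ∈ M_c(S_β)`: the complex measure `μ` is carried by a compact subset of the sector `S_β`. -/
def IsCompactlySupportedIn (μ : ComplexMeasure ℂ) (β : ℝ) : Prop :=
  ∃ K : Set ℂ, IsCompact K ∧ K ⊆ sector β ∧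
    ∀ E : Set ℂ, MeasurableSet E → Disjoint E K → μ E = 0

/-- The Bochner integral `∫ f dμ` of a vector-valued function against a complex measure. -/
def cintegral {E : Type*} [NormedAddCommGroup E] [NormedSpace ℂ E]
    (μ : ComplexMeasure ℂ) (f : ℂ → E) : E :=
  VectorMeasure.integral μ f (ContinuousLinearMap.lsmul ℝ ℂ : ℂ →L[ℝ] E →L[ℝ] E).flip

/-- The Fourier--Borel transform `F(z) = ∫ e^{-zξ} dμ(ξ)`. -/
def fourierBorel (μ : ComplexMeasure ℂ) (z : ℂ) : ℂ :=
  cintegral μ fun ξ => Complex.exp (-z * ξ)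

/-- The function `F̃(z) = conj (F (conj z))`. -/
def tildeFun (F : ℂ → ℂ) (z : ℂ) : ℂ := conj (F (conj z))

/-- The measure `μ̃`, `μ̃(E) = conj (μ (conj E))`, whose Fourier--Borel transform is `F̃` when `F`
is that of `μ`. -/
def tildeMeasure (μ : ComplexMeasure ℂ) : ComplexMeasure ℂ :=
  (μ.map (fun z : ℂ => conj z)).mapRange (starRingEnd ℂ).toAddMonoidHom Complex.continuous_conj

/-! ### Analytic semigroups of operators -/

variable {X : Type*} [NormedAddCommGroup X] [NormedSpace ℂ X]

/-- `(T(t))_{t ∈ S_α}` is an analytic semigroup of bounded operators on `X`; the values of `T`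
outside the sector are irrelevant. -/
structure IsAnalyticSemigroup (α : ℝ) (T : ℂ → X →L[ℂ] X) : Prop where
  analytic : DifferentiableOn ℂ T (sector α)
  map_add : ∀ s ∈ sector α, ∀ t ∈ sector α, T (s + t) = T s * T t

/-- The semigroup is quasinilpotent if each `T(t)` has spectral radius zero. -/
def IsQuasinilpotentSemigroup (α : ℝ) (T : ℂ → X →L[ℂ] X) : Prop :=
  ∀ t ∈ sector α, spectralRadius ℂ (T t) = 0

/-- The operator `F(-uA) = ∫ T(uξ) dμ(ξ)`, where `F` is the Fourier--Borel transform of `μ` and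
`A` is the generator of `T`. -/
def functionalCalculus (T : ℂ → X →L[ℂ] X) (μ : ComplexMeasure ℂ) (u : ℂ) : X →L[ℂ] X :=
  cintegral μ fun ξ => T (u * ξ)

/-- The closed subalgebra `𝒜_T` of the bounded operators generated by `T(t)`, `t ∈ S_α`
(no identity is adjoined). -/
def semigroupAlgebra (α : ℝ) (T : ℂ → X →L[ℂ] X) : NonUnitalSubalgebra ℂ (X →L[ℂ] X) :=
  (NonUnitalAlgebra.adjoin ℂ (T '' sector α)).topologicalClosure

theorem mem_semigroupAlgebra {α : ℝ} (T : ℂ → X →L[ℂ] X) {t : ℂ} (ht : t ∈ sector α) :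
    T t ∈ semigroupAlgebra α T :=
  NonUnitalSubalgebra.le_topologicalClosure _
    (NonUnitalAlgebra.subset_adjoin ℂ (Set.mem_image_of_mem T ht))

/-! ### The radical and the quotient by it -/

section Radical

variable (R : Type*) [NonUnitalRing R] [Module ℂ R] [IsScalarTower ℂ R R] [SMulCommClass ℂ R R]

/-- The Jacobson radical of a not necessarily unital complex algebra `R`, that is
`rad R = R ∩ rad R⁺` with `R⁺` the algebra obtained by adjoining an identity. -/
def rad : Submodule ℂ R where
  carrier := {a | (a : Unitization ℂ R) ∈ Ring.jacobson (Unitization ℂ R)}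
  zero_mem' := by simp
  add_mem' {a b} ha hb := by
    simpa only [Set.mem_ofPred_eq, Unitization.inr_add] using add_mem ha hb
  smul_mem' c a ha := by
    have h : ((c • a : R) : Unitization ℂ R) = algebraMap ℂ (Unitization ℂ R) c * a := by
      rw [← Algebra.smul_def, Unitization.inr_smul]
    simpa only [Set.mem_ofPred_eq, h] using Ideal.mul_mem_left _ _ ha

variable {R}

theorem mul_mem_rad_left (a : R) {b : R} (hb : b ∈ rad R) : a * b ∈ rad R := by
  change ((a * b : R) : Unitization ℂ R) ∈ Ring.jacobson (Unitization ℂ R)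
  rw [Unitization.inr_mul]
  exact Ideal.mul_mem_left _ _ hb

theorem mul_mem_rad_right {a : R} (b : R) (ha : a ∈ rad R) : a * b ∈ rad R := by
  change ((a * b : R) : Unitization ℂ R) ∈ Ring.jacobson (Unitization ℂ R)
  rw [Unitization.inr_mul]
  exact Ideal.mul_mem_right _ _ ha

/-- The product of `R / rad R`, induced by that of `R`. -/
instance : Mul (R ⧸ rad R) where
  mul := Quotient.map₂ (· * ·) fun a₁ a₂ ha b₁ b₂ hb => by
    rw [← Quotient.eq_iff_equiv] at *
    refine (Submodule.Quotient.eq (rad R)).2 ?_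
    have h₁ := (Submodule.Quotient.eq (rad R)).1 ha
    have h₂ := (Submodule.Quotient.eq (rad R)).1 hb
    have h : a₁ * b₁ - a₂ * b₂ = (a₁ - a₂) * b₁ + a₂ * (b₁ - b₂) := by
      rw [sub_mul, mul_sub, sub_add_sub_cancel]
    rw [h]
    exact add_mem (mul_mem_rad_right _ h₁) (mul_mem_rad_left _ h₂)

theorem mk_mul (a b : R) :
    (Submodule.Quotient.mk (a * b) : R ⧸ rad R) = Submodule.Quotient.mk a * Submodule.Quotient.mk b :=
  rfl

/-- `R / rad R` is a ring. -/
instance : NonUnitalRing (R ⧸ rad R) where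
  __ := (inferInstance : AddCommGroup (R ⧸ rad R))
  left_distrib := by
    rintro ⟨a⟩ ⟨b⟩ ⟨c⟩
    exact congrArg Submodule.Quotient.mk (mul_add a b c)
  right_distrib := by
    rintro ⟨a⟩ ⟨b⟩ ⟨c⟩
    exact congrArg Submodule.Quotient.mk (add_mul a b c)
  zero_mul := by
    rintro ⟨a⟩
    exact congrArg Submodule.Quotient.mk (zero_mul a)
  mul_zero := by
    rintro ⟨a⟩
    exact congrArg Submodule.Quotient.mk (mul_zero a)
  mul_assoc := by
    rintro ⟨a⟩ ⟨b⟩ ⟨c⟩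
    exact congrArg Submodule.Quotient.mk (mul_assoc a b c)

end Radical

/-- The radical of a Banach algebra is closed, so that the quotient seminorm on `R / rad R` is a
norm. -/
theorem isClosed_rad (R : Type*) [NonUnitalNormedRing R] [NormedSpace ℂ R] [IsScalarTower ℂ R R]
    [SMulCommClass ℂ R R] [CompleteSpace R] : IsClosed (rad R : Set R) := by
  let e : Unitization ℂ R ≃ₐ[ℂ] WithLp 1 (Unitization ℂ R) :=
    (WithLp.unitizationAlgEquiv (𝕜 := ℂ) (A := R) ℂ).symm
  have : RingHomSurjective (e : Unitization ℂ R →+* WithLp 1 (Unitization ℂ R)) := ⟨e.surjective⟩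
  have : RingHomSurjective (e.symm : WithLp 1 (Unitization ℂ R) →+* Unitization ℂ R) :=
    ⟨e.symm.surjective⟩
  have h : (rad R : Set R) = (fun a : R => WithLp.toLp 1 (a : Unitization ℂ R)) ⁻¹'
      (Ring.jacobson (WithLp 1 (Unitization ℂ R)) : Set (WithLp 1 (Unitization ℂ R))) :=
    Set.ext fun a =>
      ⟨fun ha => Ring.le_comap_jacobson
        (e : Unitization ℂ R →+* WithLp 1 (Unitization ℂ R)) ha,
      fun ha => Ring.le_comap_jacobson
        (e.symm : WithLp 1 (Unitization ℂ R) →+* Unitization ℂ R) ha⟩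
  rw [h]
  refine IsClosed.preimage WithLp.unitization_isometry_inr.continuous ?_
  rw [Ring.jacobson_eq_sInf_isMaximal, Submodule.coe_sInf]
  exact isClosed_biInter fun I hI => Ideal.IsMaximal.isClosed (hI := hI)

/-! ### The semigroup `π(T(t))` and its generator -/

/-- `𝒜_T / rad 𝒜_T`. -/
abbrev quotientAlgebra (α : ℝ) (T : ℂ → X →L[ℂ] X) : Type _ :=
  semigroupAlgebra α T ⧸ rad (semigroupAlgebra α T)

open Classical in
/-- The semigroup `π(T(t))`, `t ∈ S_α`, where `π : 𝒜_T → 𝒜_T / rad 𝒜_T` is the canonical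
surjection (with the irrelevant value `0` outside the sector). -/
def quotientSemigroup (α : ℝ) (T : ℂ → X →L[ℂ] X) (t : ℂ) : quotientAlgebra α T :=
  if ht : t ∈ sector α then Submodule.Quotient.mk ⟨T t, mem_semigroupAlgebra T ht⟩ else 0

/-- `B` is the infinitesimal generator of the semigroup `S` acting by multiplication on the
algebra `Q`: the domain of `B` consists of all `x` for which `(S(t) x - x) / t` converges as
`t → 0+`, and `B x` is this limit. -/
def IsGenerator {Q : Type*} [NonUnitalRing Q] [Module ℂ Q] [TopologicalSpace Q]
    (S : ℂ → Q) (B : Q →ₗ.[ℂ] Q) : Prop :=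
  ∀ x y : Q, (x, y) ∈ B.graph ↔
    Tendsto (fun t : ℝ => (t : ℂ)⁻¹ • (S t * x - x)) (𝓝[>] 0) (𝓝 y)

/-- The generator of `S` is an everywhere defined bounded operator. -/
def HasBoundedGenerator {Q : Type*} [NonUnitalRing Q] [Module ℂ Q] [TopologicalSpace Q]
    (S : ℂ → Q) : Prop :=
  ∃ B : Q →ₗ.[ℂ] Q, IsGenerator S B ∧ B.domain = ⊤ ∧ Continuous B

/-- The algebra `Q` has a (nonzero) two-sided identity element. -/
def IsUnital (Q : Type*) [NonUnitalRing Q] : Prop :=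
  ∃ e : Q, e ≠ 0 ∧ ∀ x : Q, e * x = x ∧ x * e = x

end AnalyticSemigroup

end

open MeasureTheory Filter Topology
open scoped ENNReal ComplexConjugate

noncomputable section

namespace AnalyticSemigroup

/-! ### Integration against complex measures -/

section VectorMeasure

variable {Y V V' E E' G G' : Type*} {mY : MeasurableSpace Y}
  [NormedAddCommGroup V] [NormedSpace ℝ V] [NormedAddCommGroup V'] [NormedSpace ℝ V']
  [NormedAddCommGroup E] [NormedSpace ℝ E] [NormedAddCommGroup E'] [NormedSpace ℝ E']
  [NormedAddCommGroup G] [NormedSpace ℝ G] [NormedAddCommGroup G'] [NormedSpace ℝ G']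

/-! The proof is Gelfand theory on the commutative Banach algebra `𝒜_T`, whose radical is the common
kernel of its characters. A nonzero character χ cannot vanish on the whole semigroup, which
generates `𝒜_T`, so χ(T(t)) = e^{-tl} for some exponent l (`exists_eq_exp`), and χ(F(-uA)) = F(ul).
Everything reduces to showing that the exponents form a bounded set.

Put G = F·F̃ and let s be the left-hand supremum. As |χ(a)| ≤ ρ(a), one has |G(tl)| ≤ s for every
exponent l and every small t in S_{α-β}. If the exponents were unbounded, some l_n → ∞ would have
directions converging to a unit vector w. Rescaling gives |G| ≤ s on the whole rotated sector
w·S_{α-β}, while |χ(T(t))| ≤ ‖T(t)‖ forces |arg w| ≤ π/2 - α. Since |G| is invariant under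
conjugation (the reason for the factor F̃), the bound holds on both rays of argument ±θ, where θ =
|arg w| + α - β ≤ π/2 - β. Between them G is bounded, because the measures live in S_β, so
Phragmén–Lindelöf spreads the bound s over a sector containing S_{α-β}, against the hypothesis
(`exists_norm_le_of_sector_estimate`).

With bounded exponents, for a small real s > 0 each nonzero character takes a value near 1 at x =
T(s). Holomorphic functional calculus then gives v in `𝒜_T` inverting x modulo the radical
(`exists_character_apply_eq_inv`). Hence xv is an identity there, and T(t) ≡ T(s+t)v transports
differentiability at s to the origin, so that the generator is multiplication by T'(s)v. -/

omit [NormedSpace ℝ V] [NormedSpace ℝ V'] in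
theorem variation_mapRange_le (μ : VectorMeasure Y V) (L : V →+ V') (hL : Continuous L)
    {K : NNReal} (hK : ∀ v, ‖L v‖₊ ≤ K * ‖v‖₊) :
    (μ.mapRange L hL).variation ≤ K • μ.variation := by
  refine VectorMeasure.variation_le_of_forall_enorm_le fun s hs => ?_
  rw [VectorMeasure.mapRange_apply, Measure.smul_apply, Measure.nnreal_smul_coe_apply]
  refine le_trans ?_ (mul_le_mul_right (VectorMeasure.enorm_measure_le_variation μ s) _)
  rw [enorm_eq_nnnorm, enorm_eq_nnnorm, ← ENNReal.coe_mul]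
  exact_mod_cast hK _

/-- Linear maps compatible with the pairings commute with the integral. -/
theorem map_integral_mapRange [CompleteSpace G] [CompleteSpace G']
    (μ : VectorMeasure Y V) [IsFiniteMeasure μ.variation]
    (B : E →L[ℝ] V →L[ℝ] G) (B' : E' →L[ℝ] V' →L[ℝ] G')
    (L₁ : E →L[ℝ] E') (L₂ : G →L[ℝ] G') (L₃ : V →+ V') (hL₃ : Continuous L₃)
    {K : NNReal} (hK : ∀ v, ‖L₃ v‖₊ ≤ K * ‖v‖₊)
    (hL : ∀ x v, L₂ (B x v) = B' (L₁ x) (L₃ v)) {f : Y → E} (hf : μ.Integrable f) :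
    L₂ (μ.integral f B) = (μ.mapRange L₃ hL₃).integral (fun y => L₁ (f y)) B' := by
  set ν := μ.mapRange L₃ hL₃ with hν
  have hle : ν.variation ≤ K • μ.variation := variation_mapRange_le μ L₃ hL₃ hK
  have hfin : IsFiniteMeasure ν.variation := isFiniteMeasure_of_le _ hle
  have hac : ν.variation ≪ μ.variation := Measure.absolutelyContinuous_of_le_smul hle
  have hint' : ∀ {g : Y → E}, μ.Integrable g → ν.Integrable g := fun {g} hg =>
    (hg.smul_measure_nnreal (c := K)).mono_measure hle
  have hint : ∀ {g : Y → E}, μ.Integrable g → ν.Integrable (fun y => L₁ (g y)) := fun {g} hg =>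
    L₁.integrable_comp (hint' hg)
  refine Integrable.induction (μ := μ.variation) (fun f => L₂ (μ.integral f B) =
    ν.integral (fun y => L₁ (f y)) B') ?_ ?_ ?_ ?_ hf
  · intro c s hs _
    have h1 : μ.integral (s.indicator fun _ => c) B = B c (μ s) :=
      setToFun_indicator_const _ hs (measure_ne_top _ _) c
    have h2 : (fun y => L₁ (s.indicator (fun _ => c) y)) = s.indicator fun _ => L₁ c := by
      ext y; by_cases hy : y ∈ s <;> simp [hy]
    have h3 : ν.integral (s.indicator fun _ => L₁ c) B' = B' (L₁ c) (ν s) :=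
      setToFun_indicator_const _ hs (measure_ne_top _ _) (L₁ c)
    rw [h1, h2, h3, hL]
    rfl
  · intro f g _ hf hg ihf ihg
    have h2 : (fun y => L₁ ((f + g) y)) = (fun y => L₁ (f y)) + fun y => L₁ (g y) := by
      ext y; simp
    rw [h2, VectorMeasure.integral_add (hint hf) (hint hg), ← ihf, ← ihg,
      VectorMeasure.integral_add hf hg, map_add]
  -- The right side factors through the continuous map from L¹ of `μ.variation` to L¹ of
  -- `ν.variation`, which exists because `ν.variation ≤ K • μ.variation`.
  · refine isClosed_eq (L₂.continuous.comp VectorMeasure.continuous_integral) ?_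
    have hcont := (VectorMeasure.continuous_integral (μ := ν) (B := B')).comp
      ((L₁.compLpL 1 ν.variation).continuous.comp
        (continuous_L1_toL1 (μ := μ.variation) (G := E) (K : ℝ≥0∞) ENNReal.coe_ne_top hle))
    refine hcont.congr fun f => VectorMeasure.integral_congr_ae ?_
    refine EventuallyEq.trans (L₁.coeFn_compLp _) ?_
    filter_upwards [(hint' (L1.integrable_coeFn f)).coeFn_toL1] with y hy
    rw [hy]
  · intro f g hfg hf ih
    have h2 : (fun y => L₁ (f y)) =ᵐ[ν.variation] fun y => L₁ (g y) :=
      hac.ae_le (hfg.fun_comp L₁)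
    rw [← VectorMeasure.integral_congr_ae hfg, ih, VectorMeasure.integral_congr_ae h2]

end VectorMeasure

theorem isFiniteMeasure_variation_of_signedMeasure {Y : Type*} {mY : MeasurableSpace Y} (μ : SignedMeasure Y) :
    IsFiniteMeasure μ.variation := by
  rw [← SignedMeasure.totalVariation_eq_variation]
  infer_instance

instance isFiniteMeasure_variation_complexMeasure {Y : Type*} {mY : MeasurableSpace Y}
    (μ : ComplexMeasure Y) : IsFiniteMeasure μ.variation := by
  have h1 := isFiniteMeasure_variation_of_signedMeasure (ComplexMeasure.re μ)
  have h2 := isFiniteMeasure_variation_of_signedMeasure (ComplexMeasure.im μ)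
  refine isFiniteMeasure_of_le ((ComplexMeasure.re μ).variation + (ComplexMeasure.im μ).variation)
    (VectorMeasure.variation_le_of_forall_enorm_le fun s hs => ?_)
  have h : ‖μ s‖ₑ ≤ ‖ComplexMeasure.re μ s‖ₑ + ‖ComplexMeasure.im μ s‖ₑ := by
    rw [← ofReal_norm, ← ofReal_norm, ← ofReal_norm, ← ENNReal.ofReal_add (norm_nonneg _) (norm_nonneg _)]
    exact ENNReal.ofReal_le_ofReal (Complex.norm_le_abs_re_add_abs_im _)
  rw [Measure.add_apply]
  exact h.trans (add_le_add (VectorMeasure.enorm_measure_le_variation _ s)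
    (VectorMeasure.enorm_measure_le_variation _ s))

variable {E E' : Type*} [NormedAddCommGroup E] [NormedSpace ℂ E] [CompleteSpace E]
  [NormedAddCommGroup E'] [NormedSpace ℂ E'] [CompleteSpace E']

theorem map_cintegral (μ : ComplexMeasure ℂ) (L : E →L[ℂ] E') {f : ℂ → E}
    (hf : μ.Integrable f) : L (cintegral μ f) = cintegral μ fun ξ => L (f ξ) := by
  have h := map_integral_mapRange μ (ContinuousLinearMap.lsmul ℝ ℂ : ℂ →L[ℝ] E →L[ℝ] E).flip
    (ContinuousLinearMap.lsmul ℝ ℂ : ℂ →L[ℝ] E' →L[ℝ] E').flip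
    (L.restrictScalars ℝ) (L.restrictScalars ℝ) (AddMonoidHom.id ℂ) continuous_id (K := 1)
    (fun v => by simp) (fun x v => by simp) hf
  rwa [VectorMeasure.mapRange_id] at h

theorem conj_cintegral (μ : ComplexMeasure ℂ) {f : ℂ → ℂ} (hf : μ.Integrable f) :
    conj (cintegral μ f) =
      cintegral (μ.mapRange (starRingEnd ℂ).toAddMonoidHom Complex.continuous_conj)
        fun ξ => conj (f ξ) :=
  map_integral_mapRange μ (ContinuousLinearMap.lsmul ℝ ℂ : ℂ →L[ℝ] ℂ →L[ℝ] ℂ).flip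
    (ContinuousLinearMap.lsmul ℝ ℂ : ℂ →L[ℝ] ℂ →L[ℝ] ℂ).flip
    (Complex.conjCLE : ℂ →L[ℝ] ℂ) (Complex.conjCLE : ℂ →L[ℝ] ℂ)
    (starRingEnd ℂ).toAddMonoidHom Complex.continuous_conj (K := 1)
    (fun v => by simp) (fun x v => by simp) hf

theorem ae_mem_of_forall_disjoint {μ : ComplexMeasure ℂ} {K : Set ℂ} (hK : IsCompact K)
    (hμ : ∀ E : Set ℂ, MeasurableSet E → Disjoint E K → μ E = 0) :
    ∀ᵐ ξ ∂μ.variation, ξ ∈ K := by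
  rw [ae_iff]
  exact (VectorMeasure.variation_apply_eq_zero hK.measurableSet.compl).2 fun t ht hm =>
    hμ t hm (Set.disjoint_left.2 fun x hx => ht hx)

omit [NormedSpace ℂ E] [CompleteSpace E] in
theorem integrable_of_continuousOn {μ : ComplexMeasure ℂ} {K : Set ℂ} (hK : IsCompact K)
    (hμ : ∀ E : Set ℂ, MeasurableSet E → Disjoint E K → μ E = 0) {f : ℂ → E}
    (hf : ContinuousOn f K) : μ.Integrable f := by
  have h : IntegrableOn f K μ.variation := hf.integrableOn_compact hK
  rwa [IntegrableOn, Measure.restrict_eq_self_of_ae_mem (ae_mem_of_forall_disjoint hK hμ)] at h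

theorem integrable_exp {μ : ComplexMeasure ℂ} {K : Set ℂ} (hK : IsCompact K)
    (hμ : ∀ E : Set ℂ, MeasurableSet E → Disjoint E K → μ E = 0) (z : ℂ) :
    μ.Integrable fun ξ => Complex.exp (-z * ξ) :=
  integrable_of_continuousOn hK hμ (by fun_prop)

omit [CompleteSpace E] in
theorem tendsto_cintegral {ι : Type*} {l : Filter ι} [l.IsCountablyGenerated]
    (μ : ComplexMeasure ℂ) {g : ι → ℂ → E} {f : ℂ → E}
    (hg : ∀ i, AEStronglyMeasurable (g i) μ.variation) {C : ℝ}
    (hC : ∀ᶠ i in l, ∀ᵐ ξ ∂μ.variation, ‖g i ξ‖ ≤ C)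
    (hlim : ∀ ξ, Tendsto (fun i => g i ξ) l (𝓝 (f ξ))) :
    Tendsto (fun i => cintegral μ (g i)) l (𝓝 (cintegral μ f)) :=
  VectorMeasure.tendsto_integral_filter_of_norm_le_const (Eventually.of_forall hg) ⟨C, hC⟩
    (Eventually.of_forall hlim)

/-! ### Fourier–Borel transforms of compactly carried measures. -/

theorem differentiable_fourierBorel {μ : ComplexMeasure ℂ} {K : Set ℂ} (hK : IsCompact K)
    (hμ : ∀ E : Set ℂ, MeasurableSet E → Disjoint E K → μ E = 0) :
    Differentiable ℂ (fourierBorel μ) := by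
  intro z
  obtain ⟨R, hR0, hR⟩ : ∃ R : ℝ, 0 < R ∧ ∀ ξ ∈ K, ‖ξ‖ ≤ R := by
    obtain ⟨R, hR⟩ := hK.isBounded.exists_norm_le
    exact ⟨max R 1, by positivity, fun ξ hξ => (hR ξ hξ).trans (le_max_left _ _)⟩
  refine (hasDerivAt_iff_tendsto_slope_zero.2
    (?_ : Tendsto _ _ (𝓝 (cintegral μ fun ξ => -ξ * Complex.exp (-z * ξ))))).differentiableAt
  have hslope : ∀ h : ℂ, h⁻¹ • (fourierBorel μ (z + h) - fourierBorel μ z) =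
      cintegral μ fun ξ => h⁻¹ • (Complex.exp (-(z + h) * ξ) - Complex.exp (-z * ξ)) := by
    intro h
    have h1 := map_cintegral μ (h⁻¹ • ContinuousLinearMap.id ℂ ℂ)
      ((integrable_exp hK hμ (z + h)).sub (integrable_exp hK hμ z))
    rw [show cintegral μ _ = fourierBorel μ (z + h) - fourierBorel μ z from
      VectorMeasure.integral_sub (integrable_exp hK hμ (z + h)) (integrable_exp hK hμ z)] at h1
    exact h1
  simp_rw [hslope]
  have hae := ae_mem_of_forall_disjoint hK hμ
  -- Dominated convergence for the difference quotients: |e^{-zξ}| ≤ e^{‖z‖R}, and |e^{-hξ} - 1| ≤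
  -- 2|hξ| as soon as |hξ| ≤ 1.
  refine tendsto_cintegral μ (C := Real.exp (‖z‖ * R) * (2 * R)) ?_ ?_ ?_
  · refine fun h => Continuous.aestronglyMeasurable ?_
    fun_prop
  · have hsmall : ∀ᶠ h : ℂ in 𝓝[≠] 0, ‖h‖ < R⁻¹ := by
      refine nhdsWithin_le_nhds ?_
      have := Metric.ball_mem_nhds (0 : ℂ) (inv_pos.2 hR0)
      filter_upwards [this] with h hh using by simpa using hh
    filter_upwards [hsmall, self_mem_nhdsWithin] with h hh hne
    filter_upwards [hae] with ξ hξ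
    have hh0 : 0 < ‖h‖ := norm_pos_iff.2 hne
    have hξR := hR ξ hξ
    have e1 : Complex.exp (-(z + h) * ξ) - Complex.exp (-z * ξ) =
        Complex.exp (-z * ξ) * (Complex.exp (-(h * ξ)) - 1) := by
      rw [mul_sub, ← Complex.exp_add]; ring_nf
    have e2 : ‖Complex.exp (-z * ξ)‖ ≤ Real.exp (‖z‖ * R) := by
      refine (Complex.norm_exp_le_exp_norm _).trans (Real.exp_le_exp.2 ?_)
      rw [norm_mul, norm_neg]
      gcongr
    have e3 : ‖Complex.exp (-(h * ξ)) - 1‖ ≤ 2 * (‖h‖ * R) := by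
      have : ‖-(h * ξ)‖ ≤ ‖h‖ * R := by rw [norm_neg, norm_mul]; gcongr
      refine (Complex.norm_exp_sub_one_le (this.trans ?_)).trans (by gcongr)
      calc ‖h‖ * R ≤ R⁻¹ * R := by gcongr
        _ = 1 := inv_mul_cancel₀ hR0.ne'
    rw [e1, norm_smul, norm_mul, norm_inv]
    calc ‖h‖⁻¹ * (‖Complex.exp (-z * ξ)‖ * ‖Complex.exp (-(h * ξ)) - 1‖)
        ≤ ‖h‖⁻¹ * (Real.exp (‖z‖ * R) * (2 * (‖h‖ * R))) := by gcongr
      _ = Real.exp (‖z‖ * R) * (2 * R) := by field_simp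
  · intro ξ
    have h0 : HasDerivAt (fun w : ℂ => -w * ξ) (-ξ) z := by
      simpa using (hasDerivAt_id z).neg.mul_const ξ
    have hd : HasDerivAt (fun w : ℂ => Complex.exp (-w * ξ)) (-ξ * Complex.exp (-z * ξ)) z := by
      rw [mul_comm]
      exact h0.cexp
    have h1 := hasDerivAt_iff_tendsto_slope_zero.1 hd
    beta_reduce at h1
    exact h1

theorem tildeMeasure_eq_map_mapRange (μ : ComplexMeasure ℂ) :
    tildeMeasure μ = (μ.mapRange (starRingEnd ℂ).toAddMonoidHom Complex.continuous_conj).map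
      fun z : ℂ => conj z := by
  have hm : Measurable fun z : ℂ => conj z := Complex.continuous_conj.measurable
  ext s hs : 1
  rw [tildeMeasure, VectorMeasure.mapRange_apply, VectorMeasure.map_apply _ hm hs,
    VectorMeasure.map_apply _ hm hs, VectorMeasure.mapRange_apply]

theorem fourierBorel_tildeMeasure {μ : ComplexMeasure ℂ} {K : Set ℂ} (hK : IsCompact K)
    (hμ : ∀ E : Set ℂ, MeasurableSet E → Disjoint E K → μ E = 0) (z : ℂ) :
    fourierBorel (tildeMeasure μ) z = tildeFun (fourierBorel μ) z := by
  have hemb : Topology.IsClosedEmbedding fun z : ℂ => conj z :=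
    (starL (R := ℂ) (A := ℂ)).toHomeomorph.isClosedEmbedding
  rw [tildeFun, fourierBorel, fourierBorel, conj_cintegral μ (integrable_exp hK hμ _),
    tildeMeasure_eq_map_mapRange, cintegral, hemb.integral_map_vectorMeasure, cintegral]
  congr 1
  ext ξ
  rw [← Complex.exp_conj]
  simp

theorem tildeMeasure_apply_eq_zero {μ : ComplexMeasure ℂ} {K : Set ℂ}
    (hμ : ∀ E : Set ℂ, MeasurableSet E → Disjoint E K → μ E = 0) :
    ∀ E : Set ℂ, MeasurableSet E → Disjoint E ((fun z : ℂ => conj z) '' K) →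
      tildeMeasure μ E = 0 := by
  have hm : Measurable fun z : ℂ => conj z := Complex.continuous_conj.measurable
  intro E hE hd
  rw [tildeMeasure, VectorMeasure.mapRange_apply, VectorMeasure.map_apply _ hm hE, hμ _ (hm hE)]
  · simp
  · exact Set.disjoint_left.2 fun x hx hxK =>
      Set.disjoint_left.1 hd (Set.mem_preimage.1 hx) (Set.mem_image_of_mem _ hxK)

/-! ### Characters and the radical -/

section Characters

theorem apply_resolvent {B : Type*} [Ring B] [Algebra ℂ B] (ψ : B →ₐ[ℂ] ℂ) {x : B} {ζ : ℂ}
    (h : ζ ∈ resolventSet ℂ x) : ψ (resolvent x ζ) = (ζ - ψ x)⁻¹ := by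
  have h1 : ψ (algebraMap ℂ B ζ - x) * ψ (resolvent x ζ) = 1 := by
    rw [← map_mul, resolvent, Ring.mul_inverse_cancel _ h, map_one]
  rw [map_sub, AlgHom.commutes] at h1
  exact eq_inv_of_mul_eq_one_right h1

/-- A holomorphic functional calculus, for the function that is `0` near `0` and `z⁻¹` near `1`. -/
theorem exists_apply_eq_inv {B : Type*} [NormedCommRing B] [NormedAlgebra ℂ B] [CompleteSpace B]
    (x : B) {r : ℝ} (hr0 : 0 < r) (hr1 : r < 1)
    (hx : ∀ ψ : B →ₐ[ℂ] ℂ, ψ x = 0 ∨ ‖ψ x - 1‖ < r) :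
    ∃ v : B, ∀ ψ : B →ₐ[ℂ] ℂ, ψ v = (ψ x)⁻¹ := by
  -- Spectral values are character values: they are 0, at distance 1 > r from the centre, or lie
  -- strictly inside the circle.
  have hres : ∀ ζ ∈ Metric.sphere (1 : ℂ) r, ζ ∈ resolventSet ℂ x := by
    intro ζ hζ
    by_contra hspec
    obtain ⟨f, hf⟩ := WeakDual.CharacterSpace.mem_spectrum_iff_exists.1
      (show ζ ∈ spectrum ℂ x from hspec)
    have hζ' : ‖ζ - 1‖ = r := by simpa [dist_eq_norm] using hζ
    rcases hx (WeakDual.CharacterSpace.toAlgHom f) with h | h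
    · have : ζ = 0 := hf.symm.trans h
      rw [this] at hζ'
      norm_num at hζ'
      exact hr1.ne hζ'.symm
    · have h' : ‖f x - 1‖ < r := h
      rw [hf, hζ'] at h'
      exact h'.false
  have h0 : ∀ ζ ∈ Metric.closedBall (1 : ℂ) r, ζ ≠ 0 := by
    rintro ζ hζ rfl
    have : (1 : ℝ) ≤ r := by simpa [dist_eq_norm] using hζ
    exact hr1.not_ge this
  have hcont : ContinuousOn (fun ζ : ℂ => ζ⁻¹ • resolvent x ζ) (Metric.sphere 1 r) := by
    intro ζ hζ
    refine ContinuousAt.continuousWithinAt ?_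
    exact (continuousAt_inv₀ (h0 ζ (Metric.sphere_subset_closedBall hζ))).smul
      (spectrum.hasDerivAt_resolvent_const_left (hres ζ hζ)).continuousAt
  have hci : CircleIntegrable (fun ζ : ℂ => ζ⁻¹ • resolvent x ζ) 1 r :=
    hcont.circleIntegrable hr0.le
  refine ⟨(2 * Real.pi * Complex.I : ℂ)⁻¹ • ∮ ζ in C(1, r), ζ⁻¹ • resolvent x ζ, fun ψ => ?_⟩
  have hψ : ψ (∮ ζ in C(1, r), ζ⁻¹ • resolvent x ζ) =
      ∮ ζ in C(1, r), (ζ - ψ x)⁻¹ • ζ⁻¹ := by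
    have h1 : ψ (∮ ζ in C(1, r), ζ⁻¹ • resolvent x ζ) =
        ∮ ζ in C(1, r), ψ (ζ⁻¹ • resolvent x ζ) := by
      have h2 := ψ.toContinuousLinearMap.intervalIntegral_comp_comm hci.out
      have h3 : ∀ b : B, ψ.toContinuousLinearMap b = ψ b := fun b => rfl
      simp only [h3, map_smul] at h2
      rw [circleIntegral, ← h2, circleIntegral]
      simp only [map_smul]
    rw [h1]
    refine circleIntegral.integral_congr hr0.le fun ζ hζ => ?_
    simp only [map_smul, apply_resolvent ψ (hres ζ hζ), smul_eq_mul, mul_comm]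
  have hpi : (2 * Real.pi * Complex.I : ℂ) ≠ 0 := by simp [Real.pi_ne_zero]
  have hinv : DifferentiableOn ℂ (fun ζ : ℂ => ζ⁻¹) (Metric.closedBall 1 r) := fun ζ hζ =>
    (differentiableAt_inv (h0 ζ hζ)).differentiableWithinAt
  rw [map_smul, hψ]
  -- If ψ x = 0 the integrand is ζ⁻², holomorphic on the disc, and the integral is 0, which is also
  -- the conventional value of `0⁻¹`. Otherwise Cauchy's formula applies.
  rcases hx ψ with h | h
  · have hd : DifferentiableOn ℂ (fun ζ : ℂ => ζ⁻¹ • ζ⁻¹) (Metric.closedBall 1 r) :=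
      hinv.smul hinv
    rw [h]
    simp only [sub_zero]
    rw [hd.diffContOnCl_ball subset_rfl |>.circleIntegral_eq_zero hr0.le]
    simp
  · have hmem : ψ x ∈ Metric.ball (1 : ℂ) r := by simpa [dist_eq_norm] using h
    rw [(hinv.diffContOnCl_ball subset_rfl).circleIntegral_sub_inv_smul hmem, smul_smul,
      inv_mul_cancel₀ hpi, one_smul]

variable {R : Type*} [NonUnitalNormedRing R] [NormedSpace ℂ R] [IsScalarTower ℂ R R]
  [SMulCommClass ℂ R R]

/-- The unitization of a commutative normed algebra, as a commutative normed algebra. -/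
abbrev unitizationNormedCommRing (hcomm : ∀ a b : R, a * b = b * a) :
    NormedCommRing (WithLp 1 (Unitization ℂ R)) where
  __ := (inferInstance : NormedRing (WithLp 1 (Unitization ℂ R)))
  mul_comm a b := by
    refine (WithLp.unitizationAlgEquiv (𝕜 := ℂ) (A := R) ℂ).injective ?_
    rw [map_mul, map_mul]
    refine Unitization.ext ?_ ?_
    · simp [mul_comm]
    · simp [hcomm, add_comm]

/-- The extension of a character to the unitization. -/
def extendCharacter (χ : R →ₙₐ[ℂ] ℂ) : WithLp 1 (Unitization ℂ R) →ₐ[ℂ] ℂ :=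
  (Unitization.lift χ).comp (WithLp.unitizationAlgEquiv (𝕜 := ℂ) (A := R) ℂ).toAlgHom

theorem extendCharacter_inr (χ : R →ₙₐ[ℂ] ℂ) (a : R) :
    extendCharacter χ (WithLp.toLp 1 (a : Unitization ℂ R)) = χ a := by
  change Unitization.lift χ (a : Unitization ℂ R) = χ a
  simp

/-- The restriction of a character of the unitization. -/
def restrictCharacter (ψ : WithLp 1 (Unitization ℂ R) →ₐ[ℂ] ℂ) : R →ₙₐ[ℂ] ℂ :=
  Unitization.lift.symm
    (ψ.comp (WithLp.unitizationAlgEquiv (𝕜 := ℂ) (A := R) ℂ).symm.toAlgHom)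

theorem norm_character_le [CompleteSpace R] (χ : R →ₙₐ[ℂ] ℂ) (a : R) : ‖χ a‖ ≤ ‖a‖ := by
  have h := AlgHom.norm_apply_le_self_mul_norm_one (extendCharacter χ)
    (WithLp.toLp 1 (a : Unitization ℂ R))
  have h1 : ‖(1 : WithLp 1 (Unitization ℂ R))‖ = 1 := by
    rw [WithLp.unitization_norm_def]
    change ‖(1 : Unitization ℂ R).fst‖ + ‖(1 : Unitization ℂ R).snd‖ = 1
    simp
  rwa [extendCharacter_inr, WithLp.unitization_norm_inr, h1, mul_one] at h

/-- A character as a continuous linear map. -/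
def characterCLM [CompleteSpace R] (χ : R →ₙₐ[ℂ] ℂ) : R →L[ℂ] ℂ :=
  LinearMap.mkContinuous { toFun := χ, map_add' := map_add χ, map_smul' := map_smul χ } 1
    fun a => by rw [one_mul]; exact norm_character_le χ a

theorem characterCLM_apply [CompleteSpace R] (χ : R →ₙₐ[ℂ] ℂ) (a : R) :
    characterCLM χ a = χ a :=
  rfl

/-- The kernel of the extended character is a maximal ideal of the unitization. -/
theorem character_eq_zero_of_mem_rad {a : R} (ha : a ∈ rad R) (χ : R →ₙₐ[ℂ] ℂ) : χ a = 0 := by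
  have h : (a : Unitization ℂ R) ∈ Ring.jacobson (Unitization ℂ R) := ha
  rw [Ring.jacobson_eq_sInf_isMaximal, Submodule.mem_sInf] at h
  have hmax : (RingHom.ker (Unitization.lift χ : Unitization ℂ R →ₐ[ℂ] ℂ)).IsMaximal :=
    RingHom.ker_isMaximal_of_surjective _ fun z => ⟨algebraMap ℂ _ z, by simp⟩
  simpa [RingHom.mem_ker] using h _ hmax

/-- By Gelfand–Mazur each maximal ideal of the unitization is killed by a character. Were `a`
outside it, `y * a + i = 1` with `i` in the ideal would map to 0 = 1. -/
theorem mem_rad_of_forall_character [CompleteSpace R] (hcomm : ∀ a b : R, a * b = b * a) {a : R}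
    (ha : ∀ χ : R →ₙₐ[ℂ] ℂ, χ a = 0) : a ∈ rad R := by
  let _ := unitizationNormedCommRing hcomm
  let e : Unitization ℂ R ≃ₐ[ℂ] WithLp 1 (Unitization ℂ R) :=
    (WithLp.unitizationAlgEquiv (𝕜 := ℂ) (A := R) ℂ).symm
  have : RingHomSurjective (e.symm : WithLp 1 (Unitization ℂ R) →+* Unitization ℂ R) :=
    ⟨e.symm.surjective⟩
  refine Ring.le_comap_jacobson (e.symm : WithLp 1 (Unitization ℂ R) →+* Unitization ℂ R)
    (?_ : WithLp.toLp 1 (a : Unitization ℂ R) ∈ Ring.jacobson (WithLp 1 (Unitization ℂ R)))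
  rw [Ring.jacobson_eq_sInf_isMaximal, Submodule.mem_sInf]
  intro (I : Ideal _) (hI : I.IsMaximal)
  by_contra hnot
  obtain ⟨y, i, hi, hy⟩ := hI.exists_inv hnot
  let ψ := WeakDual.CharacterSpace.toAlgHom (Ideal.toCharacterSpace I)
  have h1 : ψ i = 0 := Ideal.toCharacterSpace_apply_eq_zero_of_mem I hi
  have h2 : ψ (WithLp.toLp 1 (a : Unitization ℂ R)) = 0 := ha (restrictCharacter ψ)
  have h3 := congrArg ψ hy
  rw [map_add, map_mul, h1, h2, map_one] at h3
  simp at h3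

theorem exists_character_apply_eq_inv [CompleteSpace R] (hcomm : ∀ a b : R, a * b = b * a) (x : R)
    {r : ℝ} (hr0 : 0 < r) (hr1 : r < 1)
    (hx : ∀ χ : R →ₙₐ[ℂ] ℂ, χ x = 0 ∨ ‖χ x - 1‖ < r) :
    ∃ v : R, ∀ χ : R →ₙₐ[ℂ] ℂ, χ v = (χ x)⁻¹ := by
  let _ := unitizationNormedCommRing hcomm
  obtain ⟨V, hV⟩ := exists_apply_eq_inv (WithLp.toLp 1 (x : Unitization ℂ R)) hr0 hr1
    fun ψ => hx (restrictCharacter ψ)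
  -- The zero character of `R` extends to the scalar part on the unitization. It sends `x` to 0,
  -- hence `V` to `0⁻¹ = 0`, so `V` lies in `R` itself.
  have h0 : (WithLp.ofLp V).fst = 0 := by
    have h1 := hV (extendCharacter (0 : R →ₙₐ[ℂ] ℂ))
    rw [extendCharacter_inr] at h1
    have h2 : extendCharacter (0 : R →ₙₐ[ℂ] ℂ) V = (WithLp.ofLp V).fst := by
      change Unitization.lift (0 : R →ₙₐ[ℂ] ℂ) (WithLp.ofLp V) = _
      simp [Unitization.lift, NonUnitalAlgHom.toAlgHom]
    rw [← h2, h1]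
    simp
  have hVeq : V = WithLp.toLp 1 (((WithLp.ofLp V).snd : R) : Unitization ℂ R) := by
    refine (WithLp.unitizationAlgEquiv (𝕜 := ℂ) (A := R) ℂ).injective ?_
    change WithLp.ofLp V = ((WithLp.ofLp V).snd : Unitization ℂ R)
    exact Unitization.ext (by simp [h0]) (by simp)
  refine ⟨(WithLp.ofLp V).snd, fun χ => ?_⟩
  have h1 := hV (extendCharacter χ)
  rwa [hVeq, extendCharacter_inr, extendCharacter_inr] at h1

end Characters

/-! ### Characters and the spectral radius in an ambient Banach algebra. -/

section IsometricEmbedding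

variable {B : Type*} [NormedRing B] [NormedAlgebra ℂ B] [CompleteSpace B]
  {R : Type*} [NonUnitalNormedRing R] [NormedSpace ℂ R] [IsScalarTower ℂ R R]
  [SMulCommClass ℂ R R] [CompleteSpace R]

omit [CompleteSpace B] in
-- Homomorphisms shrink spectra, and the spectrum in the commutative unitization consists of
-- character values.
theorem spectralRadius_eq_zero_of_forall_character
    (hcomm : ∀ a b : R, a * b = b * a) (ι : R →ₙₐ[ℂ] B) (a : R) (ha : ∀ χ : R →ₙₐ[ℂ] ℂ, χ a = 0) :
    spectralRadius ℂ (ι a) = 0 := by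
  let _ := unitizationNormedCommRing hcomm
  let φ : WithLp 1 (Unitization ℂ R) →ₐ[ℂ] B :=
    (Unitization.lift ι).comp
      (WithLp.unitizationAlgEquiv (𝕜 := ℂ) (A := R) ℂ).toAlgHom
  have hφ : φ (WithLp.toLp 1 (a : Unitization ℂ R)) = ι a := by
    change Unitization.lift ι (a : Unitization ℂ R) = ι a
    simp
  rw [← nonpos_iff_eq_zero]
  refine iSup₂_le fun z hz => ?_
  rw [← hφ] at hz
  obtain ⟨f, hf⟩ := WeakDual.CharacterSpace.mem_spectrum_iff_exists.1
    (AlgHom.spectrum_apply_subset φ _ hz)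
  have h1 : f (WithLp.toLp 1 (a : Unitization ℂ R)) = 0 :=
    ha (restrictCharacter (WeakDual.CharacterSpace.toAlgHom f))
  simp [← hf, h1]

/-- Contractivity of χ on the powers of `a`, combined with Gelfand's formula in `B`. Only positive
powers are used, since `R` need not have an identity. -/
theorem enorm_character_le_spectralRadius (ι : R →ₙₐ[ℂ] B) (hι : ∀ a, ‖ι a‖ = ‖a‖)
    (χ : R →ₙₐ[ℂ] ℂ) (a : R) :
    ‖χ a‖ₑ ≤ spectralRadius ℂ (ι a) := by
  have hpow : ∀ n : ℕ, ∃ b : R, ι b = (ι a) ^ (n + 1) ∧ χ b = χ a ^ (n + 1) := by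
    intro n
    induction n with
    | zero => exact ⟨a, by simp, by simp⟩
    | succ n ih =>
      obtain ⟨b, hb, hχ⟩ := ih
      exact ⟨b * a, by rw [map_mul, hb, pow_succ (ι a) (n + 1)],
        by rw [map_mul, hχ, pow_succ (χ a) (n + 1)]⟩
  refine ge_of_tendsto (spectrum.pow_nnnorm_pow_one_div_tendsto_nhds_spectralRadius (ι a)) ?_
  filter_upwards [eventually_gt_atTop 0] with n hn
  obtain ⟨m, rfl⟩ := Nat.exists_eq_succ_of_ne_zero hn.ne'
  obtain ⟨b, hb, hχ⟩ := hpow m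
  have h1 : ‖χ a‖ₑ ^ (m + 1) ≤ (‖ι a ^ (m + 1)‖₊ : ℝ≥0∞) := by
    rw [← enorm_pow, ← hχ, ← hb, enorm_eq_nnnorm]
    exact ENNReal.coe_le_coe.2 ((norm_character_le χ b).trans_eq (hι b).symm)
  have h2 := ENNReal.rpow_le_rpow h1 (z := 1 / ((m + 1 : ℕ) : ℝ)) (by positivity)
  rwa [← ENNReal.rpow_natCast, ← ENNReal.rpow_mul, mul_one_div_cancel (by positivity),
    ENNReal.rpow_one] at h2

end IsometricEmbedding

/-! ### Sectors -/

section Sector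

variable {θ : ℝ}

/-- In this form, free of `arg`, openness and stability under sums are immediate. -/
theorem mem_sector_iff (hθ : 0 < θ) (hθ' : θ < Real.pi / 2) {z : ℂ} :
    z ∈ sector θ ↔ |z.im| < Real.tan θ * z.re := by
  have htan : 0 < Real.tan θ := Real.tan_pos_of_pos_of_lt_pi_div_two hθ hθ'
  have key : ∀ hz : 0 < z.re, |z.arg| < θ ↔ |z.im| < Real.tan θ * z.re := by
    intro hz
    have h1 : |z.arg| < Real.pi / 2 := Complex.abs_arg_lt_pi_div_two_iff.2 (Or.inl hz)
    have h2 : Real.tan |z.arg| = |z.im| / z.re := by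
      rcases abs_cases z.arg with ⟨h, h'⟩ | ⟨h, h'⟩
      · rw [h, Complex.tan_arg, abs_of_nonneg (Complex.arg_nonneg_iff.1 h')]
      · rw [h, Real.tan_neg, Complex.tan_arg, abs_of_neg (Complex.arg_neg_iff.1 h'), neg_div]
    rw [← div_lt_iff₀ hz, ← h2]
    exact (Real.strictMonoOn_tan.lt_iff_lt
      ⟨by linarith [abs_nonneg z.arg, Real.pi_pos], h1⟩ ⟨by linarith [Real.pi_pos], hθ'⟩).symm
  constructor
  · exact fun h => (key h.1).1 h.2
  · intro h
    have hz : 0 < z.re := pos_of_mul_pos_right ((abs_nonneg _).trans_lt h) htan.le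
    exact ⟨hz, (key hz).2 h⟩

theorem isOpen_sector (hθ : 0 < θ) (hθ' : θ < Real.pi / 2) : IsOpen (sector θ) := by
  have h : sector θ = {z : ℂ | |z.im| < Real.tan θ * z.re} := Set.ext fun z =>
    mem_sector_iff hθ hθ'
  rw [h]
  exact isOpen_lt (by fun_prop) (by fun_prop)

theorem add_mem_sector (hθ : 0 < θ) (hθ' : θ < Real.pi / 2) {z w : ℂ} (hz : z ∈ sector θ)
    (hw : w ∈ sector θ) : z + w ∈ sector θ := by
  rw [mem_sector_iff hθ hθ'] at *
  rw [Complex.add_im, Complex.add_re, mul_add]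
  exact (abs_add_le _ _).trans_lt (add_lt_add hz hw)

theorem real_mul_mem_sector {r : ℝ} (hr : 0 < r) {z : ℂ} (hz : z ∈ sector θ) :
    (r : ℂ) * z ∈ sector θ := by
  refine ⟨by rw [Complex.re_ofReal_mul]; exact mul_pos hr hz.1, ?_⟩
  rw [Complex.arg_real_mul _ hr]
  exact hz.2

theorem ofReal_mem_sector (hθ : 0 < θ) {r : ℝ} (hr : 0 < r) : (r : ℂ) ∈ sector θ :=
  ⟨by simpa using hr, by rw [Complex.arg_ofReal_of_nonneg hr.le, abs_zero]; exact hθ⟩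

theorem convex_sector (hθ : 0 < θ) (hθ' : θ < Real.pi / 2) : Convex ℝ (sector θ) := by
  refine convex_iff_forall_pos.2 fun z hz w hw a b ha hb _ => ?_
  rw [Complex.real_smul, Complex.real_smul]
  exact add_mem_sector hθ hθ' (real_mul_mem_sector ha hz) (real_mul_mem_sector hb hw)

theorem conj_mem_sector {z : ℂ} (hz : z ∈ sector θ) : conj z ∈ sector θ := by
  have h1 : |z.arg| < Real.pi / 2 := Complex.abs_arg_lt_pi_div_two_iff.2 (Or.inl hz.1)
  refine ⟨by simpa using hz.1, ?_⟩
  rw [Complex.arg_conj, if_neg (by intro h; rw [h, abs_of_pos Real.pi_pos] at h1; linarith [Real.pi_pos]), abs_neg]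
  exact hz.2

theorem ne_zero_of_mem_sector {z : ℂ} (hz : z ∈ sector θ) : z ≠ 0 := by
  rintro rfl
  exact hz.1.false

theorem polar_mem_sector (hθ' : θ < Real.pi / 2) {r φ : ℝ} (hr : 0 < r) (hφ : |φ| < θ) :
    (r : ℂ) * Complex.exp (φ * Complex.I) ∈ sector θ := by
  have h := abs_lt.1 hφ
  refine real_mul_mem_sector hr ⟨?_, ?_⟩
  · rw [Complex.exp_ofReal_mul_I_re]
    exact Real.cos_pos_of_mem_Ioo ⟨by linarith, by linarith⟩
  · rwa [Complex.arg_exp_mul_I, toIocMod_eq_self Real.two_pi_pos |>.2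
      ⟨by linarith [Real.pi_pos], by linarith [Real.pi_pos]⟩]

theorem eq_norm_mul_exp_arg (z : ℂ) : z = (‖z‖ : ℂ) * Complex.exp (z.arg * Complex.I) :=
  (Complex.norm_mul_exp_arg_mul_I z).symm

theorem mul_mem_sector {α β : ℝ} (hα : α < Real.pi / 2) {z w : ℂ} (hz : z ∈ sector (α - β))
    (hw : w ∈ sector β) : z * w ∈ sector α := by
  rw [eq_norm_mul_exp_arg z, eq_norm_mul_exp_arg w]
  have h : (‖z‖ : ℂ) * Complex.exp (z.arg * Complex.I) * (‖w‖ * Complex.exp (w.arg * Complex.I)) =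
      ((‖z‖ * ‖w‖ : ℝ) : ℂ) * Complex.exp ((z.arg + w.arg : ℝ) * Complex.I) := by
    push_cast
    rw [add_mul, Complex.exp_add]
    ring
  rw [h]
  refine polar_mem_sector hα (mul_pos (norm_pos_iff.2 (ne_zero_of_mem_sector hz))
    (norm_pos_iff.2 (ne_zero_of_mem_sector hw))) ((abs_add_le _ _).trans_lt ?_)
  linarith [hz.2, hw.2]

/-- The real part of `z w` is nonnegative if `w ∈ S_β` and `|arg z| ≤ π / 2 - β`. -/
theorem re_polar_mul_nonneg {β r φ : ℝ} (hr : 0 ≤ r) (hφ : |φ| ≤ Real.pi / 2 - β) {w : ℂ}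
    (hw : w ∈ sector β) : 0 ≤ ((r : ℂ) * Complex.exp (φ * Complex.I) * w).re := by
  have h : (r : ℂ) * Complex.exp (φ * Complex.I) * w =
      ((r * ‖w‖ : ℝ) : ℂ) * Complex.exp ((φ + w.arg : ℝ) * Complex.I) := by
    conv_lhs => rw [eq_norm_mul_exp_arg w]
    push_cast
    rw [add_mul, Complex.exp_add]
    ring
  rw [h, Complex.re_ofReal_mul, Complex.exp_ofReal_mul_I_re]
  have h2 : |φ + w.arg| ≤ Real.pi / 2 := (abs_add_le _ _).trans (by linarith [hw.2])
  exact mul_nonneg (by positivity) (Real.cos_nonneg_of_mem_Icc (abs_le.1 h2))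

end Sector

/-! ### Semigroups of complex numbers -/

/-- A zero at t gives zeros at t/2ⁿ, and then at every u, since u - t/2ⁿ is in the open sector for
large n. So f has no zeros. Differentiating the functional equation yields f' = cf, hence
f(t)e^{-tc} is a constant k ≠ 0 with k² = k. -/
theorem exists_eq_exp {α : ℝ} (hα0 : 0 < α) (hα : α < Real.pi / 2) {f : ℂ → ℂ}
    (hd : DifferentiableOn ℂ f (sector α))
    (hadd : ∀ s ∈ sector α, ∀ t ∈ sector α, f (s + t) = f s * f t)
    (hne : ∃ t ∈ sector α, f t ≠ 0) :
    ∃ l : ℂ, ∀ t ∈ sector α, f t = Complex.exp (-(t * l)) := by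
  have hopen := isOpen_sector hα0 hα
  have hpos : ∀ t ∈ sector α, f t ≠ 0 := by
    intro t ht h0
    obtain ⟨u, hu, hfu⟩ := hne
    have hhalf : ∀ n : ℕ, ((1 / 2 : ℝ) ^ n : ℝ) * t ∈ sector α ∧ f (((1 / 2 : ℝ) ^ n : ℝ) * t) = 0 := by
      intro n
      refine ⟨real_mul_mem_sector (by positivity) ht, ?_⟩
      induction n with
      | zero => simpa using h0
      | succ n ih =>
        have hm : ((1 / 2 : ℝ) ^ (n + 1) : ℝ) * t ∈ sector α :=
          real_mul_mem_sector (by positivity) ht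
        have h1 := hadd _ hm _ hm
        rw [show (((1 / 2 : ℝ) ^ (n + 1) : ℝ) : ℂ) * t + ((1 / 2 : ℝ) ^ (n + 1) : ℝ) * t =
          ((1 / 2 : ℝ) ^ n : ℝ) * t by push_cast; ring, ih] at h1
        exact mul_self_eq_zero.1 h1.symm
    have hlim : Tendsto (fun n : ℕ => u - ((1 / 2 : ℝ) ^ n : ℝ) * t) atTop (𝓝 u) := by
      have h1 : Tendsto (fun n : ℕ => (((1 / 2 : ℝ) ^ n : ℝ) : ℂ)) atTop (𝓝 ((0 : ℝ) : ℂ)) :=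
        (Complex.continuous_ofReal.tendsto 0).comp
          (tendsto_pow_atTop_nhds_zero_of_lt_one (by norm_num) (by norm_num))
      simpa using tendsto_const_nhds.sub (h1.mul_const t)
    obtain ⟨n, hn⟩ := (hlim.eventually (hopen.mem_nhds hu)).exists
    have h2 := hadd _ hn _ (hhalf n).1
    rw [sub_add_cancel, (hhalf n).2, mul_zero] at h2
    exact hfu h2
  obtain ⟨u, hu, -⟩ := hne
  have hderiv : ∀ t ∈ sector α, HasDerivAt f (f t * (deriv f u / f u)) t := by
    intro t ht
    have hdt : HasDerivAt f (deriv f t) t := (hd.differentiableAt (hopen.mem_nhds ht)).hasDerivAt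
    have hdu : HasDerivAt f (deriv f u) u := (hd.differentiableAt (hopen.mem_nhds hu)).hasDerivAt
    have htu := add_mem_sector hα0 hα ht hu
    have hdtu : HasDerivAt f (deriv f (t + u)) (t + u) :=
      (hd.differentiableAt (hopen.mem_nhds htu)).hasDerivAt
    have h1 : deriv f (t + u) = deriv f t * f u := by
      have e1 : HasDerivAt (fun s => f (s + u)) (deriv f (t + u)) t := hdtu.comp_add_const t u
      have e2 : HasDerivAt (fun s => f (s + u)) (deriv f t * f u) t := by
        refine (hdt.mul_const (f u)).congr_of_eventuallyEq ?_
        filter_upwards [hopen.mem_nhds ht] with s hs using hadd s hs u hu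
      exact e1.unique e2
    have h2 : deriv f (t + u) = f t * deriv f u := by
      have e1 : HasDerivAt (fun s => f (t + s)) (deriv f (t + u)) u := hdtu.comp_const_add t u
      have e2 : HasDerivAt (fun s => f (t + s)) (f t * deriv f u) u := by
        refine (hdu.const_mul (f t)).congr_of_eventuallyEq ?_
        filter_upwards [hopen.mem_nhds hu] with s hs using hadd t ht s hs
      exact e1.unique e2
    convert hdt using 1
    field_simp [hpos u hu]
    rw [← h2, h1, mul_comm]
  set c := deriv f u / f u with hc
  have hgd : ∀ t ∈ sector α, HasDerivAt (fun t => f t * Complex.exp (-(t * c))) 0 t := by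
    intro t ht
    have e1 : HasDerivAt (fun t : ℂ => -(t * c)) (-c) t := by
      simpa using ((hasDerivAt_id t).mul_const c).fun_neg
    have e2 := (hderiv t ht).fun_mul e1.cexp
    rwa [show f t * c * Complex.exp (-(t * c)) + f t * (Complex.exp (-(t * c)) * -c) = 0 by ring]
      at e2
  have hconst : ∀ t ∈ sector α, f t * Complex.exp (-(t * c)) = f u * Complex.exp (-(u * c)) := by
    intro t ht
    refine (hopen.is_const_of_deriv_eq_zero (convex_sector hα0 hα).isPreconnected
      (fun s hs => (hgd s hs).differentiableAt.differentiableWithinAt)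
      (fun s hs => (hgd s hs).deriv) ht hu :)
  set k := f u * Complex.exp (-(u * c)) with hk
  have hk0 : k ≠ 0 := mul_ne_zero (hpos u hu) (Complex.exp_ne_zero _)
  have hk1 : k = 1 := by
    have h1 := hconst _ (add_mem_sector hα0 hα hu hu)
    rw [hadd u hu u hu, add_mul, neg_add, Complex.exp_add] at h1
    have h2 : k * k = k := by
      calc k * k = f u * f u * (Complex.exp (-(u * c)) * Complex.exp (-(u * c))) := by ring
        _ = k := h1
    exact mul_left_cancel₀ hk0 (by rw [h2, mul_one])
  refine ⟨-c, fun t ht => ?_⟩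
  have h1 := hconst t ht
  rw [hk1, Complex.exp_neg] at h1
  rw [mul_neg, neg_neg]
  exact (mul_inv_eq_one₀ (Complex.exp_ne_zero _)).1 h1

/-! ### A Phragmén–Lindelöf argument -/

/-- The Phragmén–Lindelöf principle in a sector, for bounded functions. -/
theorem norm_le_of_norm_le_on_rays {G : ℂ → ℂ} (hG : Differentiable ℂ G) {θ C s : ℝ} (hθ : 0 < θ)
    (hC : ∀ r φ : ℝ, 0 < r → |φ| ≤ θ → ‖G (r * Complex.exp (φ * Complex.I))‖ ≤ C)
    (hs : ∀ r φ : ℝ, 0 < r → |φ| = θ → ‖G (r * Complex.exp (φ * Complex.I))‖ ≤ s)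
    {z : ℂ} (hz0 : z ≠ 0) (hz : |z.arg| ≤ θ) : ‖G z‖ ≤ s := by
  have hexp : ∀ w : ℂ, Complex.exp w = (Real.exp w.re : ℂ) * Complex.exp (w.im * Complex.I) := by
    intro w
    rw [Complex.ofReal_exp, ← Complex.exp_add, Complex.re_add_im]
  have hz' := abs_le.1 hz
  -- The exponential carries the strip |Im w| ≤ θ to the sector. Boundedness lets the growth
  -- condition hold with exponent 0.
  have h := PhragmenLindelof.horizontal_strip (f := fun w => G (Complex.exp w)) (a := -θ) (b := θ)
    (C := s) (z := Complex.log z) (hG.comp Complex.differentiable_exp).diffContOnCl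
    ⟨0, div_pos Real.pi_pos (by linarith), 0, ?_⟩ ?_ ?_ ?_ ?_
  · simpa only [Complex.exp_log hz0] using h
  · refine Asymptotics.IsBigO.of_bound C ?_
    refine Filter.eventually_inf_principal.2 (Eventually.of_forall fun w hw => ?_)
    have hw' : |w.im| ≤ θ := abs_le.2 ⟨hw.1.le, hw.2.le⟩
    rw [hexp w]
    simpa using hC _ _ (Real.exp_pos w.re) hw'
  · intro w hw
    rw [hexp w]
    exact hs _ _ (Real.exp_pos _) (by rw [hw, abs_neg, abs_of_pos hθ])
  · intro w hw
    rw [hexp w]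
    exact hs _ _ (Real.exp_pos _) (by rw [hw, abs_of_pos hθ])
  · rw [Complex.log_im]; exact hz'.1
  · rw [Complex.log_im]; exact hz'.2

theorem exists_norm_le_of_sector_estimate {α β : ℝ} (hβ : 0 < β) (hβα : β < α)
    (hα : α < Real.pi / 2) {G : ℂ → ℂ} (hG : Differentiable ℂ G) {C : ℝ}
    (hC : ∀ r φ : ℝ, 0 < r → |φ| ≤ Real.pi / 2 - β → ‖G (r * Complex.exp (φ * Complex.I))‖ ≤ C)
    (hsymm : ∀ z, ‖G (conj z)‖ = ‖G z‖) {E : Set ℂ}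
    (hE : ∀ t ∈ sector α, ∃ M : ℝ, ∀ l ∈ E, -(t * l).re ≤ M) {t₀ s : ℝ} (ht₀ : 0 < t₀)
    (hs : ∀ l ∈ E, ∀ t ∈ sector (α - β), ‖t‖ ≤ t₀ → ‖G (t * l)‖ ≤ s)
    (hlt : ∃ z ∈ sector (α - β), s < ‖G z‖) : ∃ L : ℝ, ∀ l ∈ E, ‖l‖ ≤ L := by
  by_contra! hunb
  have hαβ : 0 < α - β := sub_pos.2 hβα
  have hαβ' : α - β < Real.pi / 2 := by linarith
  choose l hlE hl using fun n : ℕ => hunb (n + 1)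
  have hlpos : ∀ n, 0 < ‖l n‖ := fun n => lt_trans (by positivity) (hl n)
  have hmem : ∀ n, l n / ‖l n‖ ∈ Metric.sphere (0 : ℂ) 1 := fun n => by
    simp [(hlpos n).ne']
  obtain ⟨w, hw, ψ, hψ, hlim⟩ := (isCompact_sphere (0 : ℂ) 1).tendsto_subseq hmem
  have hw1 : ‖w‖ = 1 := by simpa using hw
  have hw0 : w ≠ 0 := by rw [← norm_pos_iff, hw1]; exact one_pos
  have hnorm : Tendsto (fun n => ‖l (ψ n)‖) atTop atTop := by
    have h1 : Tendsto (fun n => ‖l n‖) atTop atTop :=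
      tendsto_atTop_mono (fun n => (by linarith [hl n] : (n : ℝ) ≤ ‖l n‖))
        tendsto_natCast_atTop_atTop
    exact h1.comp hψ.tendsto_atTop
  have hinv : Tendsto (fun n => ‖l (ψ n)‖⁻¹) atTop (𝓝 0) := tendsto_inv_atTop_zero.comp hnorm
  -- The lower bound -M for Re(t l) becomes 0 after division by ‖l‖ → ∞.
  have hre : ∀ t ∈ sector α, 0 ≤ (t * w).re := by
    intro t ht
    obtain ⟨M, hM⟩ := hE t ht
    have h1 : Tendsto (fun n => (t * (l (ψ n) / ‖l (ψ n)‖)).re) atTop (𝓝 (t * w).re) :=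
      (Complex.continuous_re.tendsto _).comp (hlim.const_mul t)
    have h2 : Tendsto (fun n => -M * ‖l (ψ n)‖⁻¹) atTop (𝓝 0) := by
      simpa using hinv.const_mul (-M)
    refine le_of_tendsto_of_tendsto' h2 h1 fun n => ?_
    have h3 : (t * (l (ψ n) / ‖l (ψ n)‖)).re = (t * l (ψ n)).re * ‖l (ψ n)‖⁻¹ := by
      rw [← mul_div_assoc, Complex.div_ofReal_re, div_eq_mul_inv]
    rw [h3]
    exact mul_le_mul_of_nonneg_right (by linarith [hM _ (hlE (ψ n))]) (by positivity)
  -- Write tw = (tw/l)·l: for l far out along the subsequence, tw/l is small and its direction is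
  -- close to that of t, so it is an admissible time.
  have hsw : ∀ t ∈ sector (α - β), ‖G (t * w)‖ ≤ s := by
    intro t ht
    have h1 : Tendsto (fun n => t * w / (l (ψ n) / ‖l (ψ n)‖)) atTop (𝓝 t) := by
      have := (tendsto_const_nhds (x := t * w)).div hlim hw0
      rwa [mul_div_cancel_right₀ _ hw0] at this
    have h2 : Tendsto (fun n => ‖t‖ * ‖l (ψ n)‖⁻¹) atTop (𝓝 0) := by
      simpa using hinv.const_mul ‖t‖
    obtain ⟨n, hn1, hn2⟩ := ((h1.eventually ((isOpen_sector hαβ hαβ').mem_nhds ht)).and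
      (h2.eventually (gt_mem_nhds ht₀))).exists
    have hln := hlpos (ψ n)
    have hl0 : l (ψ n) ≠ 0 := norm_pos_iff.1 hln
    have hl0' : (‖l (ψ n)‖ : ℂ) ≠ 0 := by exact_mod_cast hln.ne'
    have h3 : t * w / l (ψ n) ∈ sector (α - β) := by
      have h4 := real_mul_mem_sector (inv_pos.2 hln) hn1
      convert h4 using 1
      push_cast
      field_simp
    have h5 := hs _ (hlE (ψ n)) _ h3 (by
      rw [norm_div, norm_mul, hw1, mul_one, div_eq_mul_inv]
      exact hn2.le)
    rwa [div_mul_cancel₀ _ hl0] at h5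
  set φ := w.arg with hφ
  have hwφ : w = Complex.exp (φ * Complex.I) := by
    have := eq_norm_mul_exp_arg w
    rwa [hw1, Complex.ofReal_one, one_mul] at this
  have hcos : ∀ ρ : ℝ, |ρ| < α → 0 ≤ Real.cos (ρ + φ) := by
    intro ρ hρ
    have h1 := hre _ (polar_mem_sector hα one_pos hρ)
    rwa [hwφ, Complex.ofReal_one, one_mul, ← Complex.exp_add, ← add_mul, ← Complex.ofReal_add,
      Complex.exp_ofReal_mul_I_re] at h1
  have hφle : |φ| ≤ Real.pi / 2 - α := by
    by_contra! hgt
    have hφpi : |φ| ≤ Real.pi := Complex.abs_arg_le_pi w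
    -- An angle 0 ≤ ρ < α with ρ + |φ| strictly between π/2 and 3π/2, where the cosine is negative.
    set ρ := (max (Real.pi / 2 - |φ|) 0 + α) / 2 with hρ
    have hm0 : 0 ≤ max (Real.pi / 2 - |φ|) 0 := le_max_right _ _
    have hm1 : Real.pi / 2 - |φ| ≤ max (Real.pi / 2 - |φ|) 0 := le_max_left _ _
    have hm2 : max (Real.pi / 2 - |φ|) 0 < α := max_lt (by linarith) (by linarith)
    have hneg : Real.cos (ρ + |φ|) < 0 :=
      Real.cos_neg_of_pi_div_two_lt_of_lt (by linarith) (by linarith)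
    have hρα : |ρ| < α := by rw [abs_of_nonneg (by linarith)]; linarith
    rcases abs_cases φ with ⟨h, -⟩ | ⟨h, -⟩
    · rw [h] at hneg
      exact hneg.not_ge (hcos ρ hρα)
    · rw [h, ← Real.cos_neg, neg_add, neg_neg] at hneg
      exact hneg.not_ge (hcos (-ρ) (by rwa [abs_neg]))
  set θ := |φ| + (α - β) with hθ
  have hθ0 : 0 < θ := by positivity
  have hray : ∀ r ρ : ℝ, 0 < r → |ρ| ≤ α - β →
      ‖G (r * Complex.exp ((ρ + φ : ℝ) * Complex.I))‖ ≤ s := by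
    intro r ρ hr hρ
    have hcont : Continuous fun x : ℝ => ‖G (r * Complex.exp ((x + φ : ℝ) * Complex.I))‖ :=
      (hG.continuous.comp (by fun_prop)).norm
    have hcl : IsClosed {x : ℝ | ‖G (r * Complex.exp ((x + φ : ℝ) * Complex.I))‖ ≤ s} :=
      isClosed_le hcont continuous_const
    have hsub : Set.Ioo (-(α - β)) (α - β) ⊆
        {x : ℝ | ‖G (r * Complex.exp ((x + φ : ℝ) * Complex.I))‖ ≤ s} := by
      intro x hx
      have h1 := hsw _ (polar_mem_sector hαβ' hr (abs_lt.2 hx))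
      rwa [hwφ, mul_assoc, ← Complex.exp_add, ← add_mul, ← Complex.ofReal_add] at h1
    have h2 := hcl.closure_subset_iff.2 hsub
    rw [closure_Ioo (by linarith)] at h2
    exact h2 (abs_le.1 hρ)
  have hconj : ∀ r x : ℝ, ‖G (r * Complex.exp ((-x : ℝ) * Complex.I))‖ =
      ‖G (r * Complex.exp (x * Complex.I))‖ := by
    intro r x
    rw [← hsymm, map_mul, Complex.conj_ofReal, ← Complex.exp_conj, map_mul, Complex.conj_ofReal,
      Complex.conj_I]
    push_cast
    rw [neg_mul_neg]
  -- According to the sign of φ, the outer edge of the rotated sector has argument θ or -θ;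
  -- conjugation symmetry exchanges the two.
  have hrayθ : ∀ r : ℝ, 0 < r → ‖G (r * Complex.exp (θ * Complex.I))‖ ≤ s := by
    intro r hr
    rcases abs_cases φ with ⟨h, -⟩ | ⟨h, -⟩
    · have := hray r (α - β) hr (by rw [abs_of_pos hαβ])
      rwa [show α - β + φ = θ by rw [hθ, h]; ring] at this
    · have := hray r (-(α - β)) hr (by rw [abs_neg, abs_of_pos hαβ])
      rwa [show -(α - β) + φ = -θ by rw [hθ, h]; ring, hconj] at this
  obtain ⟨z, hz, hsz⟩ := hlt
  refine hsz.not_ge (norm_le_of_norm_le_on_rays hG hθ0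
    (fun r x hr hx => hC r x hr (by linarith)) (fun r x hr hx => ?_) (ne_zero_of_mem_sector hz)
    (by linarith [hz.2, abs_nonneg φ]))
  rcases abs_cases x with ⟨h, -⟩ | ⟨h, -⟩
  · rw [← h, hx]
    exact hrayθ r hr
  · rw [← hconj, ← h, hx]
    exact hrayθ r hr

/-- For |arg z| ≤ π/2 - β and ξ in `K` one has Re(zξ) ≥ 0, so the kernel e^{-zξ} has modulus at most
1. -/
theorem exists_norm_fourierBorel_le {β : ℝ} {μ : ComplexMeasure ℂ} {K : Set ℂ} (hK : IsCompact K)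
    (hKβ : K ⊆ sector β) (hμ : ∀ E : Set ℂ, MeasurableSet E → Disjoint E K → μ E = 0) :
    ∃ C : ℝ, 0 ≤ C ∧ ∀ r φ : ℝ, 0 < r → |φ| ≤ Real.pi / 2 - β →
      ‖fourierBorel μ (r * Complex.exp (φ * Complex.I))‖ ≤ C := by
  refine ⟨1 * ‖(ContinuousLinearMap.lsmul ℝ ℂ : ℂ →L[ℝ] ℂ →L[ℝ] ℂ).flip‖ *
    μ.variation.real Set.univ, by positivity, fun r φ hr hφ => ?_⟩
  refine VectorMeasure.norm_integral_le_of_norm_le_const ?_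
  filter_upwards [ae_mem_of_forall_disjoint hK hμ] with ξ hξ
  rw [Complex.norm_exp, Real.exp_le_one_iff, neg_mul, Complex.neg_re, neg_nonpos]
  exact re_polar_mul_nonneg hr.le hφ (hKβ hξ)

/-- The difference quotients lie in the closed range, so their limit does too, and an isometry
reflects convergence. -/
theorem hasDerivAt_codRestrict {E : Type*} [NormedAddCommGroup E] [NormedSpace ℂ E] {E' : Type*}
    [NormedAddCommGroup E'] [NormedSpace ℂ E'] (ι : E' →ₗᵢ[ℂ] E) (hι : IsClosed (Set.range ι))
    {f : ℂ → E'} {z : ℂ} (hf : DifferentiableAt ℂ (fun w => ι (f w)) z) :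
    ∃ d : E', HasDerivAt f d z := by
  have h := hasDerivAt_iff_tendsto_slope.1 hf.hasDerivAt
  have hslope : ∀ w, slope (fun w => ι (f w)) z w = ι (slope f z w) := fun w => by
    simp only [slope, vsub_eq_sub, map_smul, map_sub]
  replace h := h.congr hslope
  obtain ⟨d, hd⟩ := hι.mem_of_tendsto h (Eventually.of_forall fun w => Set.mem_range_self _)
  refine ⟨d, hasDerivAt_iff_tendsto_slope.2 ?_⟩
  rw [← hd] at h
  exact ι.isometry.isEmbedding.isInducing.tendsto_nhds_iff.2 h

/-! ### The quotient by the radical and bounded generators. -/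

section Quotient

variable {R : Type*} [NonUnitalNormedRing R] [NormedSpace ℂ R] [IsScalarTower ℂ R R]
  [SMulCommClass ℂ R R]

theorem mk_eq_mk_of_forall_character [CompleteSpace R] (hcomm : ∀ a b : R, a * b = b * a)
    {a b : R} (h : ∀ χ : R →ₙₐ[ℂ] ℂ, χ a = χ b) :
    (Submodule.Quotient.mk a : R ⧸ rad R) = Submodule.Quotient.mk b :=
  (Submodule.Quotient.eq _).2 <| mem_rad_of_forall_character hcomm fun χ => by
    rw [map_sub, h, sub_self]

/-- Left multiplication on `R / rad R` by the class of an element. -/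
def mulLeftQuotient (b : R) : R ⧸ rad R →ₗ[ℂ] R ⧸ rad R where
  toFun y := Submodule.Quotient.mk b * y
  map_add' := mul_add _
  map_smul' := by
    rintro c ⟨y⟩
    exact congrArg Submodule.Quotient.mk (mul_smul_comm c b y)

theorem continuous_mk : Continuous (Submodule.Quotient.mk : R → R ⧸ rad R) :=
  (Submodule.isOpenQuotientMap_mkQ (rad R)).continuous

theorem continuous_mulLeftQuotient (b : R) : Continuous (mulLeftQuotient b) := by
  refine (Submodule.isOpenQuotientMap_mkQ (rad R)).isQuotientMap.continuous_iff.2 ?_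
  exact continuous_mk.comp (continuous_const.mul continuous_id)

/-- A semigroup that is, modulo the radical, the translate of a differentiable function, has a
bounded generator. -/
theorem hasBoundedGenerator_of_tendsto [CompleteSpace R] {S : ℂ → R ⧸ rad R} {g : ℝ → R} {b : R}
    (hS : ∀ t : ℝ, 0 < t → ∀ y : R, (t : ℂ)⁻¹ • (S t * Submodule.Quotient.mk y -
      Submodule.Quotient.mk y) = Submodule.Quotient.mk (g t * y))
    (hg : Tendsto g (𝓝[>] 0) (𝓝 b)) : HasBoundedGenerator S := by
  -- Closedness of the radical makes the quotient Hausdorff, which gives the uniqueness of limits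
  -- needed to identify the graph.
  have hclosed : IsClosed (rad R : Set R) := isClosed_rad R
  have hT3 : T3Space (R ⧸ rad R) := inferInstance
  have hlim : ∀ y : R ⧸ rad R, Tendsto (fun t : ℝ => (t : ℂ)⁻¹ • (S t * y - y)) (𝓝[>] 0)
      (𝓝 (mulLeftQuotient b y)) := by
    rintro ⟨y⟩
    have h1 : Tendsto (fun t : ℝ => (Submodule.Quotient.mk (g t * y) : R ⧸ rad R)) (𝓝[>] 0)
        (𝓝 (Submodule.Quotient.mk (b * y))) :=
      (continuous_mk.tendsto _).comp (hg.mul_const y)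
    refine h1.congr' ?_
    filter_upwards [self_mem_nhdsWithin] with t ht
    exact (hS t ht y).symm
  refine ⟨(mulLeftQuotient b).toPMap ⊤, fun x y => ?_, rfl, ?_⟩
  · have hgraph : (x, y) ∈ ((mulLeftQuotient b).toPMap ⊤).graph ↔ mulLeftQuotient b x = y := by
      rw [LinearPMap.mem_graph_iff]
      constructor
      · rintro ⟨z, hz, hy⟩
        rw [← show (z : R ⧸ rad R) = x from hz]
        exact hy
      · exact fun h => ⟨⟨x, trivial⟩, rfl, h⟩
    rw [hgraph]
    constructor
    · rintro rfl
      exact hlim x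
    · exact fun h => tendsto_nhds_unique (hlim x) h
  · exact (continuous_mulLeftQuotient b).comp continuous_subtype_val

end Quotient

/-! ### Closed algebras of operators that contain an analytic semigroup -/

section Semigroup

variable {X : Type*} [NormedAddCommGroup X] [NormedSpace ℂ X] {α : ℝ} {T : ℂ → X →L[ℂ] X}
  {R : Type*} [NonUnitalNormedRing R] [NormedSpace ℂ R] [IsScalarTower ℂ R R]
  [SMulCommClass ℂ R R] {ι : R →ₙₐ[ℂ] (X →L[ℂ] X)} {S : ℂ → R}

/-- An isometric homomorphism as a linear isometry. -/
def toLinearIsometry (hι : ∀ a, ‖ι a‖ = ‖a‖) : R →ₗᵢ[ℂ] (X →L[ℂ] X) where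
  toFun := ι
  map_add' := map_add ι
  map_smul' := map_smul ι
  norm_map' := hι

omit [IsScalarTower ℂ R R] [SMulCommClass ℂ R R] in
theorem lift_semigroup_add (hT : IsAnalyticSemigroup α T) (hα0 : 0 < α) (hα : α < Real.pi / 2)
    (hι : ∀ a, ‖ι a‖ = ‖a‖) (hS : ∀ t ∈ sector α, ι (S t) = T t)
    {s t : ℂ} (hs : s ∈ sector α) (ht : t ∈ sector α) : S (s + t) = S s * S t := by
  refine (toLinearIsometry hι).injective ?_
  change ι _ = ι _
  rw [map_mul, hS s hs, hS t ht, hS _ (add_mem_sector hα0 hα hs ht), hT.map_add s hs t ht]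

omit [IsScalarTower ℂ R R] [SMulCommClass ℂ R R] in
theorem exists_hasDerivAt_lift_semigroup (hT : IsAnalyticSemigroup α T) (hα0 : 0 < α)
    (hα : α < Real.pi / 2) (hι : ∀ a, ‖ι a‖ = ‖a‖) (hrange : IsClosed (Set.range ι))
    (hS : ∀ t ∈ sector α, ι (S t) = T t) {t : ℂ} (ht : t ∈ sector α) :
    ∃ d, HasDerivAt S d t := by
  have hopen := (isOpen_sector hα0 hα).mem_nhds ht
  refine hasDerivAt_codRestrict (toLinearIsometry hι) hrange ?_
  refine (hT.analytic.differentiableAt hopen).congr_of_eventuallyEq ?_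
  filter_upwards [hopen] with s hs using hS s hs

variable [CompleteSpace R]

theorem isClosed_setOf_character_eq_zero (χ : R →ₙₐ[ℂ] ℂ) : IsClosed {a : R | χ a = 0} :=
  isClosed_eq (characterCLM χ).continuous continuous_const

theorem exists_character_eq_exp (hT : IsAnalyticSemigroup α T) (hα0 : 0 < α)
    (hα : α < Real.pi / 2) (hι : ∀ a, ‖ι a‖ = ‖a‖) (hrange : IsClosed (Set.range ι))
    (hS : ∀ t ∈ sector α, ι (S t) = T t) {χ : R →ₙₐ[ℂ] ℂ} (hχ : ∃ t ∈ sector α, χ (S t) ≠ 0) :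
    ∃ l : ℂ, ∀ t ∈ sector α, χ (S t) = Complex.exp (-(t * l)) := by
  refine exists_eq_exp hα0 hα (f := fun t => χ (S t)) ?_ ?_ hχ
  · intro t ht
    obtain ⟨d, hd⟩ := exists_hasDerivAt_lift_semigroup hT hα0 hα hι hrange hS ht
    exact ((characterCLM χ).hasFDerivAt.comp_hasDerivAt t hd).differentiableAt
      |>.differentiableWithinAt
  · intro s hs t ht
    simp only [lift_semigroup_add hT hα0 hα hι hS hs ht, map_mul]

variable [CompleteSpace X]

/-- The operator `F(-uA)` lies in the algebra, and the characters map it to values of `F`. -/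
theorem exists_eq_functionalCalculus (hT : IsAnalyticSemigroup α T) (hα0 : 0 < α)
    (hα : α < Real.pi / 2) (hι : ∀ a, ‖ι a‖ = ‖a‖) (hrange : IsClosed (Set.range ι))
    (hS : ∀ t ∈ sector α, ι (S t) = T t)
    {β : ℝ} {ν : ComplexMeasure ℂ} {K : Set ℂ} (hK : IsCompact K)
    (hKβ : K ⊆ sector β) (hν : ∀ E : Set ℂ, MeasurableSet E → Disjoint E K → ν E = 0)
    {u : ℂ} (hu : u ∈ sector (α - β)) :
    ∃ a : R, ι a = functionalCalculus T ν u ∧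
      ∀ (χ : R →ₙₐ[ℂ] ℂ) (l : ℂ), (∀ t ∈ sector α, χ (S t) = Complex.exp (-(t * l))) →
        χ a = fourierBorel ν (u * l) := by
  have hmem : ∀ ξ ∈ K, u * ξ ∈ sector α := fun ξ hξ => mul_mem_sector hα hu (hKβ hξ)
  have hcont : ContinuousOn (fun ξ => S (u * ξ)) K := by
    intro ξ hξ
    obtain ⟨d, hd⟩ := exists_hasDerivAt_lift_semigroup hT hα0 hα hι hrange hS (hmem ξ hξ)
    have h1 : ContinuousAt S (u * ξ) := hd.continuousAt
    exact (ContinuousAt.comp (f := fun ξ => u * ξ) h1 (by fun_prop)).continuousWithinAt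
  have hint := integrable_of_continuousOn hK hν hcont
  have hae := ae_mem_of_forall_disjoint hK hν
  refine ⟨cintegral ν fun ξ => S (u * ξ), ?_, fun χ l hχ => ?_⟩
  · have h1 := map_cintegral ν (toLinearIsometry hι).toContinuousLinearMap hint
    refine h1.trans (VectorMeasure.integral_congr_ae ?_)
    filter_upwards [hae] with ξ hξ using hS _ (hmem ξ hξ)
  · have h1 := map_cintegral ν (characterCLM χ) hint
    refine h1.trans (VectorMeasure.integral_congr_ae ?_)
    filter_upwards [hae] with ξ hξ
    rw [characterCLM_apply, hχ _ (hmem ξ hξ)]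
    congr 1
    ring

/-- The exponents of the characters are bounded. -/
theorem exists_norm_exponent_le {β : ℝ} (hβ : 0 < β) (hβα : β < α) (hα : α < Real.pi / 2)
    {μ : ComplexMeasure ℂ} (hμ : IsCompactlySupportedIn μ β) (hT : IsAnalyticSemigroup α T)
    (hι : ∀ a, ‖ι a‖ = ‖a‖) (hrange : IsClosed (Set.range ι))
    (hS : ∀ t ∈ sector α, ι (S t) = T t)
    {t₀ : ℝ} (ht₀ : 0 < t₀)
    (hsup : (⨆ t ∈ {t ∈ sector (α - β) | ‖t‖ ≤ t₀},
        spectralRadius ℂ (functionalCalculus T μ t * functionalCalculus T (tildeMeasure μ) t)) <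
      ⨆ z ∈ sector (α - β), ‖fourierBorel μ z‖ₑ * ‖tildeFun (fourierBorel μ) z‖ₑ) :
    ∃ L : ℝ, ∀ l : ℂ, (∃ χ : R →ₙₐ[ℂ] ℂ, ∀ t ∈ sector α,
      χ (S t) = Complex.exp (-(t * l))) → ‖l‖ ≤ L := by
  have hα0 : 0 < α := hβ.trans hβα
  obtain ⟨K, hK, hKβ, hμK⟩ := hμ
  have hK' : IsCompact ((fun z : ℂ => conj z) '' K) := hK.image Complex.continuous_conj
  have hKβ' : (fun z : ℂ => conj z) '' K ⊆ sector β := by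
    rintro _ ⟨z, hz, rfl⟩
    exact conj_mem_sector (hKβ hz)
  have hμK' := tildeMeasure_apply_eq_zero hμK
  set q := ⨆ t ∈ {t ∈ sector (α - β) | ‖t‖ ≤ t₀},
    spectralRadius ℂ (functionalCalculus T μ t * functionalCalculus T (tildeMeasure μ) t) with hq
  have hqtop : q ≠ ⊤ := hsup.ne_top
  set G : ℂ → ℂ := fun z => fourierBorel μ z * fourierBorel (tildeMeasure μ) z with hG
  have hGt : ∀ z, G z = fourierBorel μ z * tildeFun (fourierBorel μ) z := fun z => by
    rw [hG, ← fourierBorel_tildeMeasure hK hμK]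
  obtain ⟨C₁, hC₁, hC₁'⟩ := exists_norm_fourierBorel_le hK hKβ hμK
  obtain ⟨C₂, hC₂, hC₂'⟩ := exists_norm_fourierBorel_le hK' hKβ' hμK'
  refine exists_norm_le_of_sector_estimate hβ hβα hα (G := G) (C := C₁ * C₂)
    (E := {l : ℂ | ∃ χ : R →ₙₐ[ℂ] ℂ, ∀ t ∈ sector α,
      χ (S t) = Complex.exp (-(t * l))}) (s := q.toReal)
    ((differentiable_fourierBorel hK hμK).mul (differentiable_fourierBorel hK' hμK'))
    ?_ ?_ ?_ ht₀ ?_ ?_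
  · intro r φ hr hφ
    rw [norm_mul]
    exact mul_le_mul (hC₁' r φ hr hφ) (hC₂' r φ hr hφ) (norm_nonneg _) hC₁
  · intro z
    rw [hGt, hGt, norm_mul, norm_mul, tildeFun, tildeFun, Complex.conj_conj, RCLike.norm_conj,
      RCLike.norm_conj, mul_comm]
  -- Contractivity gives e^{-Re(tl)} ≤ ‖S(t)‖, and y + 1 ≤ e^y turns this into a bound on -Re(tl).
  · intro t ht
    refine ⟨‖S t‖, ?_⟩
    rintro l ⟨χ, hχ⟩
    have h1 := norm_character_le χ (S t)
    rw [hχ t ht, Complex.norm_exp, Complex.neg_re] at h1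
    linarith [Real.add_one_le_exp (-(t * l).re)]
  · rintro l ⟨χ, hχ⟩ t ht htt₀
    obtain ⟨a, ha, haχ⟩ := exists_eq_functionalCalculus hT hα0 hα hι hrange hS hK hKβ hμK ht
    obtain ⟨b, hb, hbχ⟩ := exists_eq_functionalCalculus hT hα0 hα hι hrange hS hK' hKβ' hμK' ht
    have h1 := enorm_character_le_spectralRadius ι hι χ (a * b)
    rw [map_mul, haχ χ l hχ, hbχ χ l hχ, map_mul, ha, hb] at h1
    have h2 : ‖G (t * l)‖ₑ ≤ q := h1.trans
      (le_iSup₂_of_le (f := fun t (_ : t ∈ {t ∈ sector (α - β) | ‖t‖ ≤ t₀}) =>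
        spectralRadius ℂ (functionalCalculus T μ t * functionalCalculus T (tildeMeasure μ) t))
        t ⟨ht, htt₀⟩ le_rfl)
    rw [← toReal_enorm]
    exact ENNReal.toReal_mono hqtop h2
  · obtain ⟨z, hz, hlt⟩ := lt_biSup_iff.1 hsup
    refine ⟨z, hz, ?_⟩
    rw [← enorm_mul, ← hGt] at hlt
    rw [← toReal_enorm]
    exact (ENNReal.toReal_lt_toReal hqtop enorm_ne_top).2 hlt

omit [CompleteSpace X] in
/-- If the exponents of the characters are bounded, then the quotient by the radical is unital and
the semigroup has a bounded generator there. -/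
theorem isUnital_and_hasBoundedGenerator (hT : IsAnalyticSemigroup α T) (hα0 : 0 < α)
    (hα : α < Real.pi / 2) (hι : ∀ a, ‖ι a‖ = ‖a‖) (hrange : IsClosed (Set.range ι))
    (hS : ∀ t ∈ sector α, ι (S t) = T t) (hcomm : ∀ a b : R, a * b = b * a)
    (hgen : ∀ χ : R →ₙₐ[ℂ] ℂ, (∀ t ∈ sector α, χ (S t) = 0) → χ = 0)
    (hTq : ¬ IsQuasinilpotentSemigroup α T) {L : ℝ}
    (hL : ∀ l : ℂ, (∃ χ : R →ₙₐ[ℂ] ℂ, ∀ t ∈ sector α, χ (S t) = Complex.exp (-(t * l))) →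
      ‖l‖ ≤ L) :
    IsUnital (R ⧸ rad R) ∧
      HasBoundedGenerator fun t => (Submodule.Quotient.mk (S t) : R ⧸ rad R) := by
  -- Chosen so that |sl| ≤ 1/4 for every exponent l, whence |e^{-sl} - 1| ≤ 1/2 < 3/4.
  set s : ℝ := (4 * (|L| + 1))⁻¹ with hs
  have hs0 : 0 < s := by positivity
  have hsS : (s : ℂ) ∈ sector α := ofReal_mem_sector hα0 hs0
  set x := S s with hx
  have hχ : ∀ χ : R →ₙₐ[ℂ] ℂ, χ = 0 ∨
      ‖χ x - 1‖ < 3 / 4 ∧ ∃ l : ℂ, ∀ t ∈ sector α,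
        χ (S t) = Complex.exp (-(t * l)) := by
    intro χ
    rcases eq_or_ne χ 0 with h0 | h0
    · exact Or.inl h0
    obtain ⟨l, hl⟩ := exists_character_eq_exp hT hα0 hα hι hrange hS (χ := χ) (by
      by_contra! h
      exact h0 (hgen χ h))
    refine Or.inr ⟨?_, l, hl⟩
    have h1 : ‖-((s : ℂ) * l)‖ ≤ 1 / 4 := by
      rw [norm_neg, norm_mul, Complex.norm_of_nonneg hs0.le]
      calc s * ‖l‖ ≤ s * (|L| + 1) := by
            gcongr
            linarith [hL l ⟨χ, hl⟩, le_abs_self L]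
        _ = 1 / 4 := by rw [hs]; field_simp
    rw [hx, hl _ hsS]
    linarith [Complex.norm_exp_sub_one_le (h1.trans (by norm_num))]
  obtain ⟨v, hv⟩ := exists_character_apply_eq_inv hcomm x (r := 3 / 4) (by norm_num) (by norm_num)
    fun χ => (hχ χ).imp (fun h => by rw [h]; rfl) fun h => h.1
  have htrans : ∀ (χ : R →ₙₐ[ℂ] ℂ), ∀ t ∈ sector α,
      χ (S (s + t) * v) = χ (S t) := by
    intro χ t ht
    rcases hχ χ with rfl | ⟨-, l, hl⟩
    · rfl
    · rw [map_mul, hv, hx, lift_semigroup_add hT hα0 hα hι hS hsS ht, map_mul, hl _ hsS, mul_comm,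
        inv_mul_cancel_left₀ (Complex.exp_ne_zero _)]
  have hunit : ∀ (χ : R →ₙₐ[ℂ] ℂ) (a : R),
      χ (x * v * a) = χ a := by
    intro χ a
    rcases hχ χ with rfl | ⟨-, l, hl⟩
    · rfl
    · rw [map_mul, map_mul, hv, hx, hl _ hsS, mul_inv_cancel₀ (Complex.exp_ne_zero _), one_mul]
  refine ⟨⟨Submodule.Quotient.mk (x * v), ?_, ?_⟩, ?_⟩
  -- If `x * v` were in the radical, every character would vanish identically, and all T(t) would
  -- have spectral radius 0.
  · intro h
    have hrad := (Submodule.Quotient.mk_eq_zero _).1 h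
    refine hTq fun t ht => ?_
    rw [← hS t ht]
    refine spectralRadius_eq_zero_of_forall_character hcomm ι _ fun χ => ?_
    rw [← hunit, map_mul, character_eq_zero_of_mem_rad hrad, zero_mul]
  · rintro ⟨a⟩
    have h1 : (Submodule.Quotient.mk (x * v * a) : R ⧸ rad R) = Submodule.Quotient.mk a :=
      mk_eq_mk_of_forall_character hcomm fun χ => hunit χ a
    have h2 : (Submodule.Quotient.mk (a * (x * v)) : R ⧸ rad R) =
        Submodule.Quotient.mk a := by rw [hcomm, h1]
    exact ⟨h1, h2⟩
  · obtain ⟨d, hd⟩ := exists_hasDerivAt_lift_semigroup hT hα0 hα hι hrange hS hsS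
    -- Modulo the radical, (S(t) - 1)/t equals (S(s+t) - S(s))v/t, a difference quotient at the
    -- interior point s, where S is differentiable.
    refine hasBoundedGenerator_of_tendsto
      (g := fun t : ℝ => (t : ℂ)⁻¹ • (S (s + t) - x) * v) (b := d * v) ?_ ?_
    · intro t ht y
      have htS : (t : ℂ) ∈ sector α := ofReal_mem_sector hα0 ht
      rw [← mk_mul, ← Submodule.Quotient.mk_sub,
        ← Submodule.Quotient.mk_smul]
      refine mk_eq_mk_of_forall_character hcomm fun χ => ?_
      simp only [map_smul, map_sub, map_mul, smul_eq_mul]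
      have h1 := htrans χ t htS
      have h2 := hunit χ y
      rw [map_mul] at h1
      rw [map_mul, map_mul] at h2
      rw [← h1]
      linear_combination ((t : ℂ)⁻¹) * h2
    · refine Tendsto.mul_const v ?_
      have h1 := hasDerivAt_iff_tendsto_slope_zero.1 hd
      refine h1.comp (tendsto_nhdsWithin_iff.2 ⟨?_, ?_⟩)
      · exact ((Complex.continuous_ofReal.tendsto 0).mono_left nhdsWithin_le_nhds)
      · filter_upwards [self_mem_nhdsWithin] with t ht
        exact Complex.ofReal_ne_zero.2 (ne_of_gt ht)

end Semigroup

/-! ### The algebra of an analytic semigroup -/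

section SemigroupAlgebra

variable {X : Type*} [NormedAddCommGroup X] [NormedSpace ℂ X] {α : ℝ} {T : ℂ → X →L[ℂ] X}

instance (A : NonUnitalSubalgebra ℂ (X →L[ℂ] X)) : NormedSpace ℂ A where
  norm_smul_le c a := norm_smul_le c (a : X →L[ℂ] X)

theorem isClosed_semigroupAlgebra : IsClosed (semigroupAlgebra α T : Set (X →L[ℂ] X)) :=
  NonUnitalSubalgebra.isClosed_topologicalClosure _

instance [CompleteSpace X] : CompleteSpace (semigroupAlgebra α T) :=
  isClosed_semigroupAlgebra.completeSpace_coe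

theorem semigroupAlgebra_mul_comm (hT : IsAnalyticSemigroup α T) (a b : semigroupAlgebra α T) :
    a * b = b * a := by
  have := NonUnitalAlgebra.isMulCommutative_adjoin ℂ (s := T '' sector α) (by
    rintro _ ⟨s, hs, rfl⟩ _ ⟨t, ht, rfl⟩
    rw [← hT.map_add s hs t ht, add_comm, hT.map_add t ht s hs])
  exact (NonUnitalSubalgebra.nonUnitalCommRingTopologicalClosure
    (NonUnitalAlgebra.adjoin ℂ (T '' sector α)) mul_comm').mul_comm a b

open Classical in
/-- `T(t)` as an element of `𝒜_T` (with the value `0` outside the sector). -/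
def semigroupElement (α : ℝ) (T : ℂ → X →L[ℂ] X) (t : ℂ) : semigroupAlgebra α T :=
  if ht : t ∈ sector α then ⟨T t, mem_semigroupAlgebra T ht⟩ else 0

theorem coe_semigroupElement {t : ℂ} (ht : t ∈ sector α) :
    (semigroupElement α T t : X →L[ℂ] X) = T t := by
  rw [semigroupElement, dif_pos ht]

theorem quotientSemigroup_eq :
    quotientSemigroup α T = fun t => Submodule.Quotient.mk (semigroupElement α T t) := by
  ext t
  rw [quotientSemigroup, semigroupElement]
  split_ifs
  · rfl
  · rfl

/-- A character that vanishes on the semigroup vanishes. -/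
theorem character_eq_zero [CompleteSpace X] {χ : semigroupAlgebra α T →ₙₐ[ℂ] ℂ}
    (h : ∀ t ∈ sector α, χ (semigroupElement α T t) = 0) : χ = 0 := by
  -- The kernel of χ, viewed among the operators: a closed subalgebra containing every T(t), hence
  -- all of `𝒜_T`.
  let N : NonUnitalSubalgebra ℂ (X →L[ℂ] X) :=
    (NonUnitalAlgHom.equalizer χ 0).map
      (NonUnitalSubalgebraClass.subtype (semigroupAlgebra α T))
  have hker : IsClosed {a : semigroupAlgebra α T | χ a = 0} :=
    isClosed_setOf_character_eq_zero (R := semigroupAlgebra α T) χ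
  have hN : IsClosed (N : Set (X →L[ℂ] X)) :=
    isClosed_semigroupAlgebra.isClosedEmbedding_subtypeVal.isClosedMap _ hker
  have hle : semigroupAlgebra α T ≤ N := by
    refine NonUnitalSubalgebra.topologicalClosure_minimal (NonUnitalAlgebra.adjoin_le ?_) hN
    rintro _ ⟨t, ht, rfl⟩
    exact ⟨semigroupElement α T t, h t ht, coe_semigroupElement ht⟩
  ext a
  obtain ⟨b, hb, hba⟩ := hle a.2
  rw [← show b = a from Subtype.ext hba]
  exact hb

/-- The inclusion of `𝒜_T` into the bounded operators. -/
def semigroupAlgebraInclusion (α : ℝ) (T : ℂ → X →L[ℂ] X) :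
    semigroupAlgebra α T →ₙₐ[ℂ] (X →L[ℂ] X) :=
  NonUnitalSubalgebraClass.subtype (semigroupAlgebra α T)

theorem norm_semigroupAlgebraInclusion (a : semigroupAlgebra α T) :
    ‖semigroupAlgebraInclusion α T a‖ = ‖a‖ :=
  rfl

theorem isClosed_range_semigroupAlgebraInclusion :
    IsClosed (Set.range (semigroupAlgebraInclusion α T)) := by
  have h : Set.range (semigroupAlgebraInclusion α T) =
      (semigroupAlgebra α T : Set (X →L[ℂ] X)) := Subtype.range_coe
  rw [h]
  exact isClosed_semigroupAlgebra

theorem semigroupAlgebraInclusion_semigroupElement {t : ℂ} (ht : t ∈ sector α) :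
    semigroupAlgebraInclusion α T (semigroupElement α T t) = T t :=
  coe_semigroupElement ht

/-- The exponents of the characters of `𝒜_T` are bounded. -/
theorem exists_norm_exponent_semigroupAlgebra_le [CompleteSpace X] {β : ℝ} (hβ : 0 < β)
    (hβα : β < α) (hα : α < Real.pi / 2) {μ : ComplexMeasure ℂ} (hμ : IsCompactlySupportedIn μ β)
    (hT : IsAnalyticSemigroup α T) {t₀ : ℝ} (ht₀ : 0 < t₀)
    (hsup : (⨆ t ∈ {t ∈ sector (α - β) | ‖t‖ ≤ t₀},
        spectralRadius ℂ (functionalCalculus T μ t * functionalCalculus T (tildeMeasure μ) t)) <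
      ⨆ z ∈ sector (α - β), ‖fourierBorel μ z‖ₑ * ‖tildeFun (fourierBorel μ) z‖ₑ) :
    ∃ L : ℝ, ∀ l : ℂ, (∃ χ : semigroupAlgebra α T →ₙₐ[ℂ] ℂ, ∀ t ∈ sector α,
      χ (semigroupElement α T t) = Complex.exp (-(t * l))) → ‖l‖ ≤ L := by
  have h := exists_norm_exponent_le (R := semigroupAlgebra α T) hβ hβα hα hμ hT
    norm_semigroupAlgebraInclusion isClosed_range_semigroupAlgebraInclusion
    (fun _ => semigroupAlgebraInclusion_semigroupElement) ht₀ hsup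
  exact h

theorem isUnital_and_hasBoundedGenerator_semigroupAlgebra [CompleteSpace X] (hα0 : 0 < α)
    (hα : α < Real.pi / 2) (hT : IsAnalyticSemigroup α T)
    (hTq : ¬ IsQuasinilpotentSemigroup α T) {L : ℝ}
    (hL : ∀ l : ℂ, (∃ χ : semigroupAlgebra α T →ₙₐ[ℂ] ℂ, ∀ t ∈ sector α,
      χ (semigroupElement α T t) = Complex.exp (-(t * l))) → ‖l‖ ≤ L) :
    IsUnital (quotientAlgebra α T) ∧ HasBoundedGenerator (quotientSemigroup α T) := by
  rw [quotientSemigroup_eq]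
  have h := isUnital_and_hasBoundedGenerator (R := semigroupAlgebra α T) hT hα0 hα
    norm_semigroupAlgebraInclusion isClosed_range_semigroupAlgebraInclusion
    (fun _ => semigroupAlgebraInclusion_semigroupElement) (semigroupAlgebra_mul_comm hT)
    (fun χ h => character_eq_zero h) hTq hL
  exact h

end SemigroupAlgebra

end AnalyticSemigroup

end

theorem mainTheorem5 {X : Type*} [NormedAddCommGroup X] [NormedSpace ℂ X] [CompleteSpace X]
    (α β : ℝ) (hβ : 0 < β) (hβα : β < α) (hα : α < Real.pi / 2)
    (μ : MeasureTheory.ComplexMeasure ℂ)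
    (hμ : AnalyticSemigroup.IsCompactlySupportedIn μ β) (hμ0 : μ Set.univ = 0)
    (T : ℂ → X →L[ℂ] X) (hT : AnalyticSemigroup.IsAnalyticSemigroup α T)
    (hTq : ¬ AnalyticSemigroup.IsQuasinilpotentSemigroup α T)
    (t₀ : ℝ) (ht₀ : 0 < t₀)
    (hsup : (⨆ t ∈ {t ∈ AnalyticSemigroup.sector (α - β) | ‖t‖ ≤ t₀},
        spectralRadius ℂ (AnalyticSemigroup.functionalCalculus T μ t *
          AnalyticSemigroup.functionalCalculus T (AnalyticSemigroup.tildeMeasure μ) t)) <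
      ⨆ z ∈ AnalyticSemigroup.sector (α - β),
        ‖AnalyticSemigroup.fourierBorel μ z‖ₑ *
          ‖AnalyticSemigroup.tildeFun (AnalyticSemigroup.fourierBorel μ) z‖ₑ) :
    AnalyticSemigroup.IsUnital (AnalyticSemigroup.quotientAlgebra α T) ∧
      AnalyticSemigroup.HasBoundedGenerator (AnalyticSemigroup.quotientSemigroup α T) := by
  obtain ⟨L, hL⟩ := AnalyticSemigroup.exists_norm_exponent_semigroupAlgebra_le hβ hβα hα hμ hT ht₀ hsup
  exact AnalyticSemigroup.isUnital_and_hasBoundedGenerator_semigroupAlgebra (hβ.trans hβα) hα hT hTq hL
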